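/- Let $n\ge 0$, $d=n+1$, and let indices $\mu,\nu$ run over $0,\dots,n$ and $i,j$ over $1,\dots,n$. On $L^2(\mathbb R^d)$, with the Schwartz space $\mathscr S(\mathbb R^d)$ as domain, let $Q^\mu$ be multiplication by the $\mu$-th coordinate and $P^\mu=-i\partial_\mu$. For real parameters $a_\mu$ and $q_\mu$ let the coordinates and their differentials be represented by $$X^\mu=\tfrac{a_\mu}{2}(Q^\mu P^\mu+P^\mu Q^\mu),\qquad dX^\mu=i\sum_\nu q_\nu[P^\nu,X^\mu].$$ Let $U(p)=\exp\big(i\sum_\mu p_\mu X^\mu\big)$, $p\in\mathbb R^d$: this is the strongly continuous unitary group of dilations $(U(p)\Phi)(q)=e^{\frac12\sum_\mu a_\mu p_\mu}\Phi(e^{a_0p_0}q_0,\dots,e^{a_np_n}q_n)$, whose generators extend the $X^\mu$. Functions $f(X)=f(X^0,\dots,X^n)$ are taken in the joint functional calculus of these commuting self-adjoint generators, in which $e^{i\sum_\mu p_\mu X^\mu}=U(p)$. For a metric $g_{\mu\nu}$ whose components are functions of the coordinates, the line-element $ds^2=\sum_{\mu,\nu}g_{\mu\nu}(\hat x)\,d\hat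 x^\mu d\hat x^\nu$ is represented by the operator $\sum_{\mu,\nu}g_{\mu\nu}(X)\,dX^\mu dX^\nu$ on its natural domain inside $\mathscr S(\mathbb R^d)$. Let $\Theta$ be a real skew-symmetric $d\times d$ matrix, $(\Theta x)_\mu=\sum_\nu\Theta_{\mu\nu}x^\nu$, and $\alpha_p(A)=U(p)AU(p)^{-1}$. The deformation (warped convolution) $A_\Theta=\int dE(x)\,\alpha_{\Theta x}(A)$, with $E$ the joint spectral measure of $U$, is understood weakly as an oscillatory integral: $A_\Theta\Phi=\eta$ means that $\Phi$ lies in the domain of every $\alpha_{\Theta x}(A)$ and that $$\langle\Psi,\eta\rangle=(2\pi)^{-d}\lim_{\epsilon\to0^+}\iint\chi(\epsilon x,\epsilon y)\,e^{-i\sum_\mu x_\mu y_\mu}\,\langle\Psi,U(y)\,\alpha_{\Theta x}(A)\Phi\rangle\,dx\,dy,$$ with absolutely convergent integrals, for all $\Psi\in L^2(\mathbb R^d)$ and all cut-off functions $\chi\in\mathscr S(\mathbb R^d\times\mathbb R^d)$, $\chi(0,0)=1$, that (like Gaussians) decay faster than every exponential in $x$ (uniformly in $y$), and whose partial Fourier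 transform in $y$ decays faster than every exponential (uniformly in $x$). Lemma. Assume $\Theta_{ij}=0$ for all spatial $i,j$. Let $\tilde a:\mathbb R\to\mathbb R$ be measurable and consider the FRW line-element $$ds^2=d\hat t^2-\tilde a(\hat t)^2\,d\hat{\mathbf x}^2,\qquad \hat t=\hat x^0,\quad d\hat{\mathbf x}^2=\sum_i(d\hat x^i)^2 .$$ Put $b_i=a_0\Theta_{0i}$ and let the functions $a^{(i)}:\mathbb R\to\mathbb R$ satisfy $a^{(i)}(t)^2=e^{-2a_i\Theta_{i0}t}\,\tilde a(t)^2$ (no summation over $i$). Then the deformed line-element is $$(ds^2)_\Theta=e^{-2\sum_i b_i\hat x^i}\,d\hat t^2-\sum_i a^{(i)}(\hat t)^2\,(d\hat x^i)^2 ,$$ that is, on the common domain of the operators representing $ds^2$ and the right-hand side, the deformation of the former exists and equals the latter. In particular, if $a_i\Theta_{i0}$ does not depend on $i$, all $a^{(i)}$ can be taken equal to one function $a$, with $a(t)^2=e^{-2a_i\Theta_{i0}t}\tilde a(t)^2$, and $(ds^2)_\Theta=e^{-2\sum_i b_i\hat x^i}\,d\hat t^2-a(\hat t)^2\,d\hat{\mathbf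 x}^2$. If $|\tilde a(t)|\le Ce^{\kappa|t|}$ for some constants $C,\kappa$, the common domain is dense in $L^2(\mathbb R^d)$. -/

import Mathlib

open MeasureTheory SchwartzMap FourierTransform Filter Topology
open scoped LineDeriv InnerProductSpace Matrix

noncomputable section

namespace WarpedFRW

/-- The space `ℝ^d`, `d = n + 1`. The index `0` is the time index, `1, …, n` are spatial. -/
abbrev Space (n : ℕ) : Type := EuclideanSpace ℝ (Fin (n + 1))

/-- The Hilbert space `L²(ℝ^d)`. -/
abbrev Hil (n : ℕ) : Type := Lp ℂ 2 (volume : Measure (Space n))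

/-! ### Schrödinger representation, coordinates and differentials on the Schwartz space -/

theorem coord_temperate {n : ℕ} (μ : Fin (n + 1)) :
    (fun x : Space n => ((x μ : ℝ) : ℂ)).HasTemperateGrowth :=
  (Complex.ofRealCLM.comp (EuclideanSpace.proj (𝕜 := ℝ) μ)).hasTemperateGrowth

/-- The position operator `Q^μ` on Schwartz functions. -/
def position {n : ℕ} (μ : Fin (n + 1)) : Module.End ℂ 𝓢(Space n, ℂ) :=
  (smulLeftCLM ℂ (fun x : Space n => ((x μ : ℝ) : ℂ))).toLinearMap

theorem position_apply {n : ℕ} (μ : Fin (n + 1)) (φ : 𝓢(Space n, ℂ)) (x : Space n) :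
    position μ φ x = (x μ : ℂ) * φ x := by
  simp [position, smulLeftCLM_apply_apply (coord_temperate μ)]

/-- The momentum operator `P^μ = -i ∂/∂q_μ` on Schwartz functions, so that `[Q, P] = i`. -/
def momentum {n : ℕ} (μ : Fin (n + 1)) : Module.End ℂ 𝓢(Space n, ℂ) :=
  (-Complex.I) •
    (LineDeriv.lineDerivOpCLM ℂ 𝓢(Space n, ℂ) (EuclideanSpace.single μ (1 : ℝ))).toLinearMap

/-- The represented coordinate `X^μ = (a_μ / 2) (Q^μ P^μ + P^μ Q^μ)`. -/
def coordOp {n : ℕ} (a : Fin (n + 1) → ℝ) (μ : Fin (n + 1)) : Module.End ℂ 𝓢(Space n, ℂ) :=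
  ((a μ / 2 : ℝ) : ℂ) • (position μ * momentum μ + momentum μ * position μ)

/-- The represented differential `dX^μ = i ∑_ν q_ν [P^ν, X^μ]`. -/
def diffOp {n : ℕ} (a q : Fin (n + 1) → ℝ) (μ : Fin (n + 1)) : Module.End ℂ 𝓢(Space n, ℂ) :=
  Complex.I • ∑ ν, ((q ν : ℝ) : ℂ) •
    (momentum ν * coordOp a μ - coordOp a μ * momentum ν)

/-! ### Weighted changes of variables on `L²` -/

/-- The diagonal linear map with entries `c`. -/
def diagMap {n : ℕ} (c : Fin (n + 1) → ℝ) : Space n →L[ℝ] Space n :=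
  LinearMap.toContinuousLinearMap (Matrix.toEuclideanLin (Matrix.diagonal c))

theorem diagMap_apply {n : ℕ} (c : Fin (n + 1) → ℝ) (x : Space n) (μ : Fin (n + 1)) :
    diagMap c x μ = c μ * x μ := by
  simp [diagMap, Matrix.toLpLin_apply, Matrix.mulVec_diagonal]

theorem diagMap_det {n : ℕ} (c : Fin (n + 1) → ℝ) : (diagMap c).det = ∏ μ, c μ := by
  simp [diagMap, ContinuousLinearMap.det, Matrix.det_diagonal, Matrix.toLpLin_eq_toLin]

/-- `w` is an admissible weight for the change of variables `T`: then `Φ ↦ w · (Φ ∘ T)` is a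
contraction of `L²`. -/
structure IsWeight {n : ℕ} (T : Space n → Space n) (w : Space n → ℝ) : Prop where
  meas : Measurable T
  cont : Continuous w
  pos : ∀ u, 0 < w u
  le : Measure.map T (volume.withDensity fun u => ENNReal.ofReal (w u ^ 2)) ≤ volume

theorem IsWeight.quasi {n : ℕ} {T : Space n → Space n} {w : Space n → ℝ} (h : IsWeight T w) :
    Measure.QuasiMeasurePreserving T volume volume := by
  refine ⟨h.meas, ?_⟩
  have h1 : (volume : Measure (Space n)) ≪
      volume.withDensity fun u => ENNReal.ofReal (w u ^ 2) := by
    apply withDensity_absolutelyContinuous'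
    · exact ((h.cont.pow 2).measurable.ennreal_ofReal).aemeasurable
    · filter_upwards with u
      have := h.pos u
      simp only [ne_eq, ENNReal.ofReal_eq_zero, not_le]
      positivity
  exact (h1.map h.meas).trans (Measure.absolutelyContinuous_of_le h.le)

theorem IsWeight.memLp {n : ℕ} {T : Space n → Space n} {w : Space n → ℝ} (h : IsWeight T w)
    (Φ : Hil n) : MemLp (fun u => (w u : ℂ) * Φ (T u)) 2 volume := by
  have hm : AEStronglyMeasurable (fun u => (w u : ℂ) * Φ (T u)) volume :=
    (Complex.continuous_ofReal.comp h.cont).aestronglyMeasurable.mul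
      ((Lp.stronglyMeasurable Φ).comp_measurable h.meas).aestronglyMeasurable
  refine ⟨hm, ?_⟩
  rw [eLpNorm_lt_top_iff_lintegral_rpow_enorm_lt_top (by norm_num) (by norm_num)]
  have hΦ := (eLpNorm_lt_top_iff_lintegral_rpow_enorm_lt_top (p := 2) (by norm_num)
    (by norm_num)).1 (Lp.memLp Φ).2
  refine lt_of_le_of_lt ?_ hΦ
  have hΦm : Measurable fun x => ‖Φ x‖ₑ ^ (2 : ENNReal).toReal :=
    (Lp.stronglyMeasurable Φ).measurable.enorm.pow_const _
  have hwm : Measurable fun u => ENNReal.ofReal (w u ^ 2) :=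
    (h.cont.pow 2).measurable.ennreal_ofReal
  calc ∫⁻ u, ‖(w u : ℂ) * Φ (T u)‖ₑ ^ (2 : ENNReal).toReal
      = ∫⁻ u, ENNReal.ofReal (w u ^ 2) * ‖Φ (T u)‖ₑ ^ (2 : ENNReal).toReal := by
        refine lintegral_congr fun u => ?_
        rw [enorm_mul, ENNReal.mul_rpow_of_nonneg _ _ (by norm_num)]
        congr 1
        rw [← ofReal_norm, Complex.norm_real, Real.norm_eq_abs, abs_of_pos (h.pos u)]
        simp [ENNReal.ofReal_pow (h.pos u).le]
    _ = ∫⁻ u, ‖Φ (T u)‖ₑ ^ (2 : ENNReal).toReal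
          ∂(volume.withDensity fun u => ENNReal.ofReal (w u ^ 2)) := by
        exact (lintegral_withDensity_eq_lintegral_mul volume hwm
          (g := fun u => ‖Φ (T u)‖ₑ ^ (2 : ENNReal).toReal) (hΦm.comp h.meas)).symm
    _ = ∫⁻ x, ‖Φ x‖ₑ ^ (2 : ENNReal).toReal
          ∂(Measure.map T (volume.withDensity fun u => ENNReal.ofReal (w u ^ 2))) :=
        (lintegral_map hΦm h.meas).symm
    _ ≤ _ := lintegral_mono' h.le le_rfl

/-- The map `Φ ↦ w · (Φ ∘ T)` on `L²`. -/
def IsWeight.pullback {n : ℕ} {T : Space n → Space n} {w : Space n → ℝ} (h : IsWeight T w) :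
    Hil n →ₗ[ℂ] Hil n where
  toFun Φ := (h.memLp Φ).toLp _
  map_add' Φ Ψ := by
    rw [← MemLp.toLp_add]
    refine MemLp.toLp_congr _ _ ?_
    filter_upwards [h.quasi.ae (Lp.coeFn_add Φ Ψ)] with u hu
    rw [Pi.add_apply] at hu
    rw [hu, Pi.add_apply, mul_add]
  map_smul' c Φ := by
    rw [RingHom.id_apply, ← MemLp.toLp_const_smul]
    refine MemLp.toLp_congr _ _ ?_
    filter_upwards [h.quasi.ae (Lp.coeFn_smul c Φ)] with u hu
    rw [hu, Pi.smul_apply, Pi.smul_apply, smul_eq_mul, smul_eq_mul, mul_left_comm]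

theorem IsWeight.pullback_coe {n : ℕ} {T : Space n → Space n} {w : Space n → ℝ}
    (h : IsWeight T w) (Φ : Hil n) : h.pullback Φ =ᵐ[volume] fun u => (w u : ℂ) * Φ (T u) :=
  (h.memLp Φ).coeFn_toLp

theorem isWeight_of_deriv {n : ℕ} {T : Space n → Space n} {w : Space n → ℝ}
    (c : Space n → Fin (n + 1) → ℝ) (hT : ∀ u, HasFDerivAt T (diagMap (c u)) u)
    (hinj : Function.Injective T) (hw : Continuous w) (hpos : ∀ u, 0 < w u)
    (hc : ∀ u, |∏ μ, c u μ| = w u ^ 2) : IsWeight T w := by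
  have hTc : Continuous T := continuous_iff_continuousAt.2 fun u => (hT u).continuousAt
  refine ⟨hTc.measurable, hw, hpos, Measure.le_iff.2 fun s hs => ?_⟩
  have hpre : MeasurableSet (T ⁻¹' s) := hTc.measurable hs
  rw [Measure.map_apply hTc.measurable hs, withDensity_apply _ hpre]
  calc ∫⁻ u in T ⁻¹' s, ENNReal.ofReal (w u ^ 2)
      = ∫⁻ u in T ⁻¹' s, ENNReal.ofReal |(diagMap (c u)).det| := by
        simp_rw [diagMap_det, hc]
    _ = volume (T '' (T ⁻¹' s)) :=
        lintegral_abs_det_fderiv_eq_addHaar_image volume hpre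
          (fun u _ => (hT u).hasFDerivWithinAt) hinj.injOn
    _ ≤ volume s := measure_mono (Set.image_preimage_subset _ _)

/-! ### The unitary group generated by the coordinates -/

theorem isWeight_dilation {n : ℕ} (s : Space n) :
    IsWeight (diagMap fun μ => Real.exp (s μ)) (fun _ => Real.exp (2⁻¹ * ∑ μ, s μ)) := by
  refine isWeight_of_deriv (fun _ μ => Real.exp (s μ)) (fun u => (diagMap _).hasFDerivAt) ?_
    continuous_const (fun _ => Real.exp_pos _) fun _ => ?_
  · intro x y hxy
    ext μ
    have := congrArg (fun v : Space n => v μ) hxy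
    simpa [diagMap_apply] using this
  · rw [← Real.exp_sum, abs_of_pos (Real.exp_pos _), ← Real.exp_nat_mul]
    congr 1
    push_cast
    ring

/-- The unitary `U(p) = exp (i ∑_μ p_μ X^μ)`. As `i X^μ = a_μ (q_μ ∂_μ + 1/2)`, it is the dilation
`(U(p) Φ)(q) = exp (½ ∑_μ a_μ p_μ) Φ(e^{a_0 p_0} q_0, …, e^{a_n p_n} q_n)`. -/
def expCoord {n : ℕ} (a : Fin (n + 1) → ℝ) (p : Space n) : Hil n →ₗ[ℂ] Hil n :=
  (isWeight_dilation (WithLp.toLp 2 fun μ => a μ * p μ)).pullback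

/-- `U` is a strongly continuous unitary representation of `ℝ^d` (its members are isometric, and
invertible by the group law) whose generators extend the operators `X^μ`, given on Schwartz
functions. -/
structure IsExponentialOf {n : ℕ} (U : Space n → Hil n →ₗ[ℂ] Hil n)
    (X : Fin (n + 1) → Module.End ℂ 𝓢(Space n, ℂ)) : Prop where
  map_zero : U 0 = LinearMap.id
  map_add : ∀ p p', U (p + p') = U p ∘ₗ U p'
  isometric : ∀ p Φ Ψ, ⟪U p Φ, U p Ψ⟫_ℂ = ⟪Φ, Ψ⟫_ℂ
  continuous : ∀ Φ, Continuous fun p => U p Φ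
  generator : ∀ (μ : Fin (n + 1)) (φ : 𝓢(Space n, ℂ)),
    HasDerivAt (fun s : ℝ => U (EuclideanSpace.single μ s) (φ.toLp 2 volume))
      (Complex.I • (X μ φ).toLp 2 volume) 0

/-! ### Joint functional calculus of the coordinates -/

/-- Logarithmic coordinates on the open orthant of sign pattern `σ`. -/
def logChart {n : ℕ} (σ : Fin (n + 1) → ℤˣ) (u : Space n) : Space n :=
  WithLp.toLp 2 fun μ => ((σ μ : ℤ) : ℝ) * Real.exp (u μ)

theorem isWeight_logChart {n : ℕ} (σ : Fin (n + 1) → ℤˣ) :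
    IsWeight (logChart σ) (fun u : Space n => Real.exp (2⁻¹ * ∑ μ, u μ)) := by
  have hσ : ∀ μ, |((σ μ : ℤ) : ℝ)| = 1 := fun μ => by
    rcases Int.units_eq_one_or (σ μ) with h | h <;> simp [h]
  refine isWeight_of_deriv (fun u μ => ((σ μ : ℤ) : ℝ) * Real.exp (u μ)) (fun u => ?_) ?_
    (by fun_prop) (fun _ => Real.exp_pos _) fun u => ?_
  · rw [← hasFDerivWithinAt_univ, hasFDerivWithinAt_euclidean]
    intro μ
    have h1 : HasFDerivAt (fun x : Space n => x μ) (EuclideanSpace.proj μ : Space n →L[ℝ] ℝ) u :=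
      (EuclideanSpace.proj μ : Space n →L[ℝ] ℝ).hasFDerivAt
    refine ((h1.exp.const_mul ((σ μ : ℤ) : ℝ)).congr_fderiv ?_).hasFDerivWithinAt
    ext v
    simp [diagMap_apply, mul_assoc]
  · intro x y hxy
    ext μ
    have h := congrArg (fun v : Space n => v μ) hxy
    have h0 : ((σ μ : ℤ) : ℝ) ≠ 0 := by
      intro h0
      have := hσ μ
      simp [h0] at this
    simpa [logChart, h0] using h
  · rw [Finset.abs_prod]
    simp_rw [abs_mul, hσ, one_mul, Real.abs_exp]
    rw [← Real.exp_sum, ← Real.exp_nat_mul]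
    congr 1
    push_cast
    ring

/-- The spectral (Mellin) transform: Fourier transform in logarithmic coordinates on each orthant,
`(M_σ Φ)(ξ) = ∫ e^{-2πi ξ·u} e^{½ ∑ u_μ} Φ(σ_0 e^{u_0}, …, σ_n e^{u_n}) du`. The `M_σ` together are
a unitary onto `2^d` copies of `L²(ℝ^d)` which takes `U(p)` to multiplication by
`exp (i ∑_μ p_μ (2π a_μ ξ_μ))`. -/
def mellin {n : ℕ} (σ : Fin (n + 1) → ℤˣ) : Hil n →ₗ[ℂ] Hil n :=
  (Lp.fourierTransformₗᵢ (Space n) ℂ).toLinearEquiv.toLinearMap ∘ₗ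
    (isWeight_logChart σ).pullback

/-- The joint spectral value of `X^0, …, X^n` at the point `ξ` of the spectral representation. -/
def spectralPoint {n : ℕ} (a : Fin (n + 1) → ℝ) (ξ : Space n) : Space n :=
  WithLp.toLp 2 fun μ => 2 * Real.pi * a μ * ξ μ

/-- The graph of `f(X^0, …, X^n)`: in the spectral representation it is multiplication by `f`. -/
def funGraph {n : ℕ} (a : Fin (n + 1) → ℝ) (f : Space n → ℂ) : Submodule ℂ (Hil n × Hil n) where
  carrier := {z | ∀ σ, mellin σ z.2 =ᵐ[volume] fun ξ => f (spectralPoint a ξ) * mellin σ z.1 ξ}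
  add_mem' := by
    intro z z' hz hz' σ
    simp only [Prod.fst_add, Prod.snd_add, map_add]
    filter_upwards [hz σ, hz' σ, Lp.coeFn_add (mellin σ z.1) (mellin σ z'.1),
      Lp.coeFn_add (mellin σ z.2) (mellin σ z'.2)] with ξ h1 h2 h3 h4
    rw [h4, h3, Pi.add_apply, Pi.add_apply, h1, h2, mul_add]
  zero_mem' := by
    intro σ
    simp only [Prod.fst_zero, Prod.snd_zero, map_zero]
    filter_upwards with ξ
    simp
  smul_mem' := by
    intro c z hz σ
    simp only [Prod.smul_fst, Prod.smul_snd, map_smul]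
    filter_upwards [hz σ, Lp.coeFn_smul c (mellin σ z.1),
      Lp.coeFn_smul c (mellin σ z.2)] with ξ h1 h3 h4
    rw [h4, h3, Pi.smul_apply, Pi.smul_apply, h1, smul_eq_mul, smul_eq_mul, mul_left_comm]

theorem exists_logChart {n : ℕ} (x : Space n) (hx : ∀ μ, x μ ≠ 0) :
    ∃ (σ : Fin (n + 1) → ℤˣ) (u : Space n), logChart σ u = x := by
  refine ⟨fun μ => if 0 < x μ then 1 else -1, WithLp.toLp 2 fun μ => Real.log |x μ|, ?_⟩
  ext μ
  simp only [logChart, Real.exp_log (abs_pos.2 (hx μ))]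
  by_cases h : 0 < x μ
  · simp [h, abs_of_pos h]
  · have : x μ < 0 := lt_of_le_of_ne (not_lt.1 h) (hx μ)
    simp [h, abs_of_neg this]

theorem logChart_differentiable {n : ℕ} (σ : Fin (n + 1) → ℤˣ) :
    Differentiable ℝ (logChart σ) := by
  rw [differentiable_euclidean]
  intro μ
  simp only [logChart]
  fun_prop

theorem mellin_injective {n : ℕ} (η : Hil n) (h : ∀ σ, mellin σ η = 0) : η = 0 := by
  have h0 : ∀ σ, ∀ᵐ u, η (logChart σ u) = 0 := by
    intro σ
    have h1 : (isWeight_logChart σ).pullback η = 0 := by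
      have := h σ
      simpa [mellin] using this
    have h2 := (isWeight_logChart σ).pullback_coe η
    rw [h1] at h2
    filter_upwards [h2, Lp.coeFn_zero ℂ 2 (volume : Measure (Space n))] with u hu hz
    rw [hz] at hu
    have := (mul_eq_zero.1 hu.symm).resolve_left (by
      exact_mod_cast (Real.exp_pos _).ne')
    exact this
  have hcoord : ∀ μ : Fin (n + 1), volume {x : Space n | x μ = 0} = 0 := by
    intro μ
    have := Measure.addHaar_submodule (volume : Measure (Space n))
      (LinearMap.ker (EuclideanSpace.proj μ : Space n →L[ℝ] ℝ).toLinearMap)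
      (by
        intro htop
        have hm : EuclideanSpace.single μ (1 : ℝ) ∈ LinearMap.ker
            (EuclideanSpace.proj μ : Space n →L[ℝ] ℝ).toLinearMap := by
          rw [htop]; trivial
        simp at hm)
    have hset : {x : Space n | x μ = 0} = (LinearMap.ker
        (EuclideanSpace.proj μ : Space n →L[ℝ] ℝ).toLinearMap : Set (Space n)) := by
      ext x
      simp
    rw [hset]
    exact this
  have himg : ∀ σ, volume (logChart σ '' {u | η (logChart σ u) ≠ 0}) = 0 := fun σ =>
    addHaar_image_eq_zero_of_differentiableOn_of_addHaar_eq_zero volume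
      (logChart_differentiable σ).differentiableOn (h0 σ)
  rw [Lp.eq_zero_iff_ae_eq_zero]
  have hnull : volume ((⋃ μ, {x : Space n | x μ = 0}) ∪
      ⋃ σ, logChart σ '' {u | η (logChart σ u) ≠ 0}) = 0 :=
    measure_union_null (measure_iUnion_null hcoord) (measure_iUnion_null himg)
  refine measure_mono_null (fun x hx => ?_) hnull
  by_cases hc : ∀ μ, x μ ≠ 0
  · obtain ⟨σ, u, rfl⟩ := exists_logChart x hc
    exact Or.inr (Set.mem_iUnion.2 ⟨σ, u, hx, rfl⟩)
  · push Not at hc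
    exact Or.inl (Set.mem_iUnion.2 hc)

/-- The operator `f(X^0, …, X^n)` with its maximal domain. -/
def funOp {n : ℕ} (a : Fin (n + 1) → ℝ) (f : Space n → ℂ) : Hil n →ₗ.[ℂ] Hil n :=
  (funGraph a f).toLinearPMap

theorem funOp_graph {n : ℕ} (a : Fin (n + 1) → ℝ) (f : Space n → ℂ) :
    (funOp a f).graph = funGraph a f := by
  refine Submodule.toLinearPMap_graph_eq _ fun z hz h0 => mellin_injective _ fun σ => ?_
  have h1 := hz σ
  rw [h0, map_zero] at h1
  rw [Lp.eq_zero_iff_ae_eq_zero]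
  filter_upwards [h1, Lp.coeFn_zero ℂ 2 (volume : Measure (Space n))] with ξ h2 h3
  rw [h2, h3]
  simp

/-! ### Partially defined operators -/

/-- The composition `B A` on its natural domain `{Φ ∈ dom A | A Φ ∈ dom B}`. -/
def pcomp {n : ℕ} (B A : Hil n →ₗ.[ℂ] Hil n) : Hil n →ₗ.[ℂ] Hil n :=
  B.comp (A.domRestrict ((B.domain.comap A.toFun).map A.domain.subtype)) (by
    rintro ⟨x, hx⟩
    obtain ⟨⟨y, hy, hyx⟩, hxA⟩ := id hx
    have h : A.domRestrict ((B.domain.comap A.toFun).map A.domain.subtype) ⟨x, hx⟩ = A y :=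
      LinearPMap.domRestrict_apply hyx.symm
    rw [h]
    exact hy)

theorem mem_pcomp_domain {n : ℕ} {B A : Hil n →ₗ.[ℂ] Hil n} {Φ : Hil n} :
    Φ ∈ (pcomp B A).domain ↔ ∃ h : Φ ∈ A.domain, A ⟨Φ, h⟩ ∈ B.domain := by
  constructor
  · rintro ⟨⟨y, hy, hyx⟩, hxA⟩
    refine ⟨hxA, ?_⟩
    have : y = ⟨Φ, hxA⟩ := Subtype.ext hyx
    exact this ▸ hy
  · rintro ⟨h, hB⟩
    exact ⟨⟨⟨Φ, h⟩, hB, rfl⟩, h⟩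

theorem pcomp_apply {n : ℕ} {B A : Hil n →ₗ.[ℂ] Hil n} {Φ : Hil n}
    (h : Φ ∈ (pcomp B A).domain) (hA : Φ ∈ A.domain) (hB : A ⟨Φ, hA⟩ ∈ B.domain) :
    pcomp B A ⟨Φ, h⟩ = B ⟨A ⟨Φ, hA⟩, hB⟩ := rfl

/-- An everywhere defined operator, as a partially defined one. -/
def everywhere {n : ℕ} (T : Hil n →ₗ[ℂ] Hil n) : Hil n →ₗ.[ℂ] Hil n := T.toPMap ⊤

/-- An operator on Schwartz functions, as a partially defined operator of `L²(ℝ^d)` with the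
Schwartz space as its domain. -/
def schwartzOp {n : ℕ} (T : Module.End ℂ 𝓢(Space n, ℂ)) : Hil n →ₗ.[ℂ] Hil n where
  domain := LinearMap.range (toLpCLM ℂ ℂ 2 (volume : Measure (Space n))).toLinearMap
  toFun := (toLpCLM ℂ ℂ 2 (volume : Measure (Space n))).toLinearMap ∘ₗ T ∘ₗ
    (LinearEquiv.ofInjective (toLpCLM ℂ ℂ 2 (volume : Measure (Space n))).toLinearMap
      (injective_toLp 2 volume)).symm.toLinearMap

theorem schwartzOp_apply {n : ℕ} (T : Module.End ℂ 𝓢(Space n, ℂ)) (φ : 𝓢(Space n, ℂ)) :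
    schwartzOp T ⟨φ.toLp 2 volume, φ, rfl⟩ = (T φ).toLp 2 volume := by
  have : (LinearEquiv.ofInjective (toLpCLM ℂ ℂ 2 (volume : Measure (Space n))).toLinearMap
      (injective_toLp 2 volume)).symm ⟨φ.toLp 2 volume, φ, rfl⟩ = φ := by
    rw [LinearEquiv.symm_apply_eq]
    rfl
  change (T _).toLp 2 volume = _
  exact congrArg (fun ψ => (T ψ).toLp 2 volume) this

/-! ### Line-elements and their deformation -/

/-- The represented line-element `∑_{μν} g_{μν}(X) dX^μ dX^ν` of a metric whose components `g_{μν}`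
are functions of the coordinates. -/
def lineElement {n : ℕ} (a q : Fin (n + 1) → ℝ)
    (g : Space n → Matrix (Fin (n + 1)) (Fin (n + 1)) ℝ) : Hil n →ₗ.[ℂ] Hil n :=
  ∑ μ, ∑ ν, pcomp (funOp a fun x => ((g x μ ν : ℝ) : ℂ)) (schwartzOp (diffOp a q μ * diffOp a q ν))

/-- The metric `N(x) dt² - ∑_i s_i(t)² (dx^i)²`, with `t = x^0`. -/
def metric {n : ℕ} (N : Space n → ℝ) (s : Fin n → ℝ → ℝ) (x : Space n) :
    Matrix (Fin (n + 1)) (Fin (n + 1)) ℝ :=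
  Matrix.diagonal (Fin.cons (N x) fun i => -(s i (x 0)) ^ 2)

/-- The vector `(Θ x)_μ = ∑_ν Θ_{μν} x^ν`. -/
def thetaVec {n : ℕ} (Θ : Matrix (Fin (n + 1)) (Fin (n + 1)) ℝ) (x : Space n) : Space n :=
  WithLp.toLp 2 fun μ => ∑ ν, Θ μ ν * x ν

/-- The adjoint action `α_p(A) = U(p) A U(p)⁻¹`, on its natural domain; `U(p)⁻¹ = U(-p)`. -/
def adjointAction {n : ℕ} (a : Fin (n + 1) → ℝ) (p : Space n) (A : Hil n →ₗ.[ℂ] Hil n) :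
    Hil n →ₗ.[ℂ] Hil n :=
  pcomp (everywhere (expCoord a p)) (pcomp A (everywhere (expCoord a (-p))))

/-- Cut-off functions `χ ∈ 𝓢(ℝ^d × ℝ^d)`, `χ(0, 0) = 1`, which, like the Gaussians, decay faster
than every exponential in `x` and in the variable dual to `y`. -/
structure IsCutoff {n : ℕ} (χ : 𝓢(Space n × Space n, ℂ)) : Prop where
  one : χ 0 = 1
  decay : ∀ c : ℝ, ∃ C : ℝ, ∀ x y, Real.exp (c * ‖x‖) * ‖χ (x, y)‖ ≤ C
  decay_fourier : ∀ c : ℝ, ∃ C : ℝ, ∀ x ξ,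
    Real.exp (c * ‖ξ‖) * ‖𝓕 (fun y => χ (x, y)) ξ‖ ≤ C

/-- The warped convolution `A_Θ = ∫ dE(x) α_{Θx}(A)` exists at `Φ` and `A_Θ Φ = η`: weakly,
`⟨Ψ, η⟩ = lim_{ε → 0} (2π)^{-d} ∬ χ(εx, εy) e^{-ixy} ⟨Ψ, U(y) α_{Θx}(A) Φ⟩ dx dy`
for every `Ψ` and every cut-off function `χ`, with absolutely convergent integrals. -/
def HasWarpedConvolution {n : ℕ} (a : Fin (n + 1) → ℝ)
    (Θ : Matrix (Fin (n + 1)) (Fin (n + 1)) ℝ) (A : Hil n →ₗ.[ℂ] Hil n) (Φ η : Hil n) : Prop :=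
  ∃ hΦ : ∀ x, Φ ∈ (adjointAction a (thetaVec Θ x) A).domain,
    ∀ χ : 𝓢(Space n × Space n, ℂ), IsCutoff χ → ∀ Ψ : Hil n,
      let F : ℝ → Space n × Space n → ℂ := fun ε z =>
        χ (ε • z) * Complex.exp (-Complex.I * ((∑ μ, z.1 μ * z.2 μ : ℝ) : ℂ)) *
          ⟪Ψ, expCoord a z.2 (adjointAction a (thetaVec Θ z.1) A ⟨Φ, hΦ z.1⟩)⟫_ℂ
      (∀ ε > 0, Integrable (F ε) volume) ∧
        Tendsto (fun ε => (((2 * Real.pi) ^ (n + 1) : ℝ) : ℂ)⁻¹ * ∫ z, F ε z) (𝓝[>] 0)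
          (𝓝 ⟪Ψ, η⟫_ℂ)

end WarpedFRW

end

noncomputable section

namespace WarpedFRW

/-! ### The spectral transform is unitary -/

/-! Up to the null coordinate hyperplanes the space is a disjoint union of orthants. In logarithmic
coordinates on each of them, weighted by the square root of the Jacobian, the dilation `U(p)`
becomes the translation by `(a_μ p_μ)`, and the Fourier transform turns it into multiplication by
the character `exp (i p · x)` at the joint spectral value `x` (`mellin_expCoord`). So `f(X)` is
multiplication by `f`, it commutes with every `U(p)`, and its products are pointwise products
(`funGraph_of_mul`).

The canonical commutation relations give `dX^μ = q_μ a_μ P^μ`, and the chain rule gives `P^μ U(p) =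
e^{a_μ p_μ} U(p) P^μ`. Hence conjugation by `U(Θx)` multiplies `(dX^μ)²` by `exp (-2 a_μ (Θx)_μ) =
exp (v_μ · x)`, where `v_μ` is `-2 a_μ` times the `μ`-th row of `Θ`, and it leaves `g_{μμ}(X)`
alone. On a vector `Φ` of the domain, `α_{Θx}(ds²) Φ = ∑_μ exp (v_μ · x) y_μ` with `y_μ = g_{μμ}(X)
(dX^μ)² Φ` (`mem_graph_adjointAction_lineElement`).

It remains to see that the oscillatory integral replaces `exp (v · x)` by `exp (v · X)`
(`tendsto_oscillatory`). Pairing with `Ψ` gives an integrable spectral density. By Fubini and the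
substitution `x = s + 2πεξ`, `y → y/ε` at a spectral value `s`, the double integral is `(2π)^d
e^{v·s}` times a kernel that is bounded for `ε ≤ 1` and tends to `χ(0, 0) = 1`. Dominated
convergence applies because `y_μ` lies in the domain of `exp (v_μ · X)`: the deformed component is
`exp (v_μ · x) g_{μμ}`. Since `Θ_{00} = Θ_{ij} = 0`, the vector `v_0` is purely spatial and the
`v_i` are purely temporal, which is the claimed form (`metricDiag_deformed`).

For density, Schwartz functions are averaged over dilations with Gaussian weights. The average is
Schwartz again, and spectrally it is multiplied by a Gaussian, which beats exponential growth of the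
metric. Narrow weights approximate the identity. -/

theorem abs_intUnit_cast (s : ℤˣ) : |((s : ℤ) : ℝ)| = 1 := by
  rcases Int.units_eq_one_or s with h | h <;> simp [h]

theorem intUnit_cast_mul_self (s : ℤˣ) : ((s : ℤ) : ℝ) * ((s : ℤ) : ℝ) = 1 := by
  rcases Int.units_eq_one_or s with h | h <;> simp [h]

/-- The density of the volume in logarithmic coordinates. -/
def logDensity {n : ℕ} (u : Space n) : ℝ := Real.exp (2⁻¹ * ∑ μ, u μ)

theorem logDensity_pos {n : ℕ} (u : Space n) : 0 < logDensity u := Real.exp_pos _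

theorem continuous_logDensity {n : ℕ} : Continuous (logDensity : Space n → ℝ) := by
  unfold logDensity
  fun_prop

/-- A common left inverse of the logarithmic charts. -/
def logAbs {n : ℕ} (x : Space n) : Space n := WithLp.toLp 2 fun μ => Real.log |x μ|

theorem logAbs_logChart {n : ℕ} (σ : Fin (n + 1) → ℤˣ) (u : Space n) :
    logAbs (logChart σ u) = u := by
  ext μ
  simp [logAbs, logChart, abs_mul, abs_intUnit_cast]

theorem logChart_injective {n : ℕ} (σ : Fin (n + 1) → ℤˣ) : Function.Injective (logChart σ) :=
  Function.LeftInverse.injective (logAbs_logChart σ)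

theorem measurable_logAbs {n : ℕ} : Measurable (logAbs : Space n → Space n) := by
  refine (WithLp.measurable_toLp 2 _).comp (measurable_pi_lambda _ fun μ => ?_)
  exact Real.measurable_log.comp (continuous_abs.measurable.comp (by fun_prop))

/-- The open orthant of sign pattern `σ`. -/
def orthant {n : ℕ} (σ : Fin (n + 1) → ℤˣ) : Set (Space n) :=
  {x | ∀ μ, 0 < ((σ μ : ℤ) : ℝ) * x μ}

theorem measurableSet_orthant {n : ℕ} (σ : Fin (n + 1) → ℤˣ) : MeasurableSet (orthant σ) := by
  have : orthant σ = ⋂ μ, {x : Space n | 0 < ((σ μ : ℤ) : ℝ) * x μ} := by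
    ext x; simp [orthant]
  rw [this]
  exact MeasurableSet.iInter fun μ => measurableSet_lt measurable_const (by fun_prop)

theorem logChart_mem_orthant {n : ℕ} (σ : Fin (n + 1) → ℤˣ) (u : Space n) :
    logChart σ u ∈ orthant σ := fun μ => by
  simp only [logChart]
  rw [← mul_assoc, intUnit_cast_mul_self, one_mul]
  exact Real.exp_pos _

theorem logChart_mem_orthant_iff {n : ℕ} (σ τ : Fin (n + 1) → ℤˣ) (u : Space n) :
    logChart τ u ∈ orthant σ ↔ τ = σ := by
  refine ⟨fun h => funext fun μ => ?_, fun h => h ▸ logChart_mem_orthant τ u⟩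
  have h1 := h μ
  simp only [logChart] at h1
  have h2 := Real.exp_pos (u μ)
  rcases Int.units_eq_one_or (σ μ) with hs | hs <;> rcases Int.units_eq_one_or (τ μ) with ht | ht <;>
    simp [hs, ht] at h1 ⊢ <;> linarith

theorem range_logChart {n : ℕ} (σ : Fin (n + 1) → ℤˣ) : Set.range (logChart σ) = orthant σ := by
  refine Set.Subset.antisymm (Set.range_subset_iff.2 (logChart_mem_orthant σ)) fun x hx => ?_
  obtain ⟨τ, u, rfl⟩ := exists_logChart x fun μ h0 => by
    have := hx μ
    simp [h0] at this
  exact ⟨u, by rw [(logChart_mem_orthant_iff σ τ u).1 hx]⟩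

theorem ae_coord_ne_zero {n : ℕ} : ∀ᵐ x : Space n, ∀ μ, x μ ≠ 0 := by
  refine ae_all_iff.2 fun μ => ?_
  have := Measure.addHaar_submodule (volume : Measure (Space n))
    (LinearMap.ker (EuclideanSpace.proj μ : Space n →L[ℝ] ℝ).toLinearMap)
    (by
      intro htop
      have hm : EuclideanSpace.single μ (1 : ℝ) ∈ LinearMap.ker
          (EuclideanSpace.proj μ : Space n →L[ℝ] ℝ).toLinearMap := by
        rw [htop]; trivial
      simp at hm)
  refine measure_mono_null (fun x hx => ?_) this
  simpa using hx

/-- The derivative of the chart is diagonal with determinant `± ∏ e^{u_μ}`, of absolute value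
`logDensity u ^ 2`. The weight in the pullback is the square root of this density, which is what
makes the pullbacks jointly isometric. -/
theorem volume_image_logChart {n : ℕ} (σ : Fin (n + 1) → ℤˣ) {s : Set (Space n)}
    (hs : MeasurableSet s) :
    volume (logChart σ '' s) = ∫⁻ u in s, ENNReal.ofReal (logDensity u ^ 2) := by
  have hd : ∀ u, HasFDerivAt (logChart σ)
      (diagMap fun μ => ((σ μ : ℤ) : ℝ) * Real.exp (u μ)) u := fun u => by
    rw [← hasFDerivWithinAt_univ, hasFDerivWithinAt_euclidean]
    intro μ
    have h1 : HasFDerivAt (fun x : Space n => x μ) (EuclideanSpace.proj μ : Space n →L[ℝ] ℝ) u :=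
      (EuclideanSpace.proj μ : Space n →L[ℝ] ℝ).hasFDerivAt
    refine ((h1.exp.const_mul ((σ μ : ℤ) : ℝ)).congr_fderiv ?_).hasFDerivWithinAt
    ext v
    simp [diagMap_apply, mul_assoc]
  rw [← lintegral_abs_det_fderiv_eq_addHaar_image volume hs
    (fun u _ => (hd u).hasFDerivWithinAt) (logChart_injective σ).injOn]
  refine lintegral_congr fun u => ?_
  rw [diagMap_det, Finset.abs_prod]
  simp_rw [abs_mul, abs_intUnit_cast, one_mul, Real.abs_exp]
  rw [← Real.exp_sum, logDensity, ← Real.exp_nat_mul]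
  congr 2
  push_cast
  ring

/-- Off the null coordinate hyperplanes the orthants partition the space, and each is the injective
image of one chart. Stated for measures, so that Lebesgue and Bochner integrals split in the same
way. -/
theorem volume_eq_sum_map_logChart {n : ℕ} : (volume : Measure (Space n)) =
    ∑ σ : Fin (n + 1) → ℤˣ, Measure.map (logChart σ)
      (volume.withDensity fun u => ENNReal.ofReal (logDensity u ^ 2)) := by
  ext s hs
  rw [Measure.finsetSum_apply]
  have h1 : volume s = volume (⋃ σ : Fin (n + 1) → ℤˣ, s ∩ orthant σ) := by
    refine measure_congr ?_
    filter_upwards [ae_coord_ne_zero] with x hx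
    obtain ⟨σ, u, rfl⟩ := exists_logChart x hx
    refine propext ⟨fun h => Set.mem_iUnion.2 ⟨σ, h, logChart_mem_orthant σ u⟩, fun h => ?_⟩
    obtain ⟨τ, h, -⟩ := Set.mem_iUnion.1 h
    exact h
  rw [h1, measure_iUnion, tsum_fintype]
  · refine Finset.sum_congr rfl fun σ _ => ?_
    have hm := (isWeight_logChart σ).meas
    rw [Measure.map_apply hm hs, withDensity_apply _ (hm hs),
      ← volume_image_logChart σ (hm hs), Set.image_preimage_eq_inter_range, range_logChart]
  · intro σ τ hst
    refine Set.disjoint_left.2 fun x hx hx' => hst ?_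
    obtain ⟨u, rfl⟩ : x ∈ Set.range (logChart σ) := range_logChart σ ▸ hx.2
    exact (logChart_mem_orthant_iff τ σ u).1 hx'.2
  · exact fun σ => hs.inter (measurableSet_orthant σ)

theorem lintegral_eq_sum_logChart {n : ℕ} {f : Space n → ENNReal} (hf : Measurable f) :
    ∫⁻ x, f x = ∑ σ : Fin (n + 1) → ℤˣ,
      ∫⁻ u, ENNReal.ofReal (logDensity u ^ 2) * f (logChart σ u) := by
  conv_lhs => rw [volume_eq_sum_map_logChart]
  rw [lintegral_finsetSum_measure]
  refine Finset.sum_congr rfl fun σ _ => ?_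
  have hm := (isWeight_logChart σ).meas
  rw [lintegral_map hf hm]
  exact lintegral_withDensity_eq_lintegral_mul volume
    (continuous_logDensity.pow 2).measurable.ennreal_ofReal (hf.comp hm)

theorem integral_eq_sum_logChart {n : ℕ} {f : Space n → ℂ} (hf : StronglyMeasurable f)
    (hi : Integrable f) :
    ∫ x, f x = ∑ σ : Fin (n + 1) → ℤˣ,
      ∫ u, ((logDensity u ^ 2 : ℝ) : ℂ) * f (logChart σ u) := by
  have hi' : Integrable f (∑ σ : Fin (n + 1) → ℤˣ, Measure.map (logChart σ)
      (volume.withDensity fun u => ENNReal.ofReal (logDensity u ^ 2))) := by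
    rwa [← volume_eq_sum_map_logChart]
  conv_lhs => rw [volume_eq_sum_map_logChart]
  rw [integral_finsetSum_measure (integrable_finsetSum_measure.1 hi')]
  refine Finset.sum_congr rfl fun σ _ => ?_
  have hm := (isWeight_logChart σ).meas
  rw [integral_map hm.aemeasurable hf.aestronglyMeasurable,
    integral_withDensity_eq_integral_toReal_smul (f := fun u => ENNReal.ofReal (logDensity u ^ 2))
      (continuous_logDensity.pow 2).measurable.ennreal_ofReal
      (by filter_upwards with u; exact ENNReal.ofReal_lt_top)]
  refine integral_congr_ae ?_
  filter_upwards with u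
  rw [ENNReal.toReal_ofReal (by positivity), Complex.real_smul]

theorem inner_eq_sum_pullback {n : ℕ} (Ψ Φ : Hil n) :
    ⟪Ψ, Φ⟫_ℂ = ∑ σ, ⟪(isWeight_logChart σ).pullback Ψ, (isWeight_logChart σ).pullback Φ⟫_ℂ := by
  rw [L2.inner_def, integral_eq_sum_logChart
    ((Lp.stronglyMeasurable Ψ).inner (Lp.stronglyMeasurable Φ)) (L2.integrable_inner Ψ Φ)]
  refine Finset.sum_congr rfl fun σ _ => ?_
  rw [L2.inner_def]
  refine integral_congr_ae ?_
  filter_upwards [(isWeight_logChart σ).pullback_coe Ψ, (isWeight_logChart σ).pullback_coe Φ]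
    with u h1 h2
  rw [h1, h2]
  simp only [RCLike.inner_apply, map_mul, Complex.conj_ofReal, logDensity]
  push_cast
  ring

theorem inner_eq_sum_mellin {n : ℕ} (Ψ Φ : Hil n) :
    ⟪Ψ, Φ⟫_ℂ = ∑ σ, ⟪mellin σ Ψ, mellin σ Φ⟫_ℂ := by
  rw [inner_eq_sum_pullback]
  exact Finset.sum_congr rfl fun σ _ => ((Lp.fourierTransformₗᵢ (Space n) ℂ).inner_map_map _ _).symm

theorem norm_sq_eq_sum_mellin {n : ℕ} (Φ : Hil n) : ‖Φ‖ ^ 2 = ∑ σ, ‖mellin σ Φ‖ ^ 2 := by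
  have h := inner_eq_sum_mellin Φ Φ
  simp_rw [inner_self_eq_norm_sq_to_K] at h
  exact_mod_cast h

/-- Surjectivity: the given functions are transported to their orthants, divided by the
half-density, and glued. It is needed to produce `f(X) η` from its spectral components. -/
theorem exists_pullback_eq {n : ℕ} (ψ : (Fin (n + 1) → ℤˣ) → Hil n) :
    ∃ Φ : Hil n, ∀ σ, (isWeight_logChart σ).pullback Φ = ψ σ := by
  classical
  let f : Space n → ℂ := fun x => ∑ σ, (orthant σ).indicator
    (fun x => ((logDensity (logAbs x) : ℝ) : ℂ)⁻¹ * ψ σ (logAbs x)) x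
  have hf : Measurable f := by
    refine Finset.measurable_sum _ fun σ _ => Measurable.indicator ?_ (measurableSet_orthant σ)
    refine Measurable.mul ?_ ((Lp.stronglyMeasurable _).measurable.comp measurable_logAbs)
    exact (Complex.measurable_ofReal.comp
      (continuous_logDensity.measurable.comp measurable_logAbs)).inv
  have hv : ∀ σ u, f (logChart σ u) = ((logDensity u : ℝ) : ℂ)⁻¹ * ψ σ u := by
    intro σ u
    simp only [f]
    rw [Finset.sum_eq_single σ]
    · rw [Set.indicator_of_mem (logChart_mem_orthant σ u), logAbs_logChart]
    · intro τ _ hτ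
      rw [Set.indicator_of_notMem]
      exact fun h => hτ ((logChart_mem_orthant_iff τ σ u).1 h).symm
    · exact fun h => absurd (Finset.mem_univ _) h
  have hL : MemLp f 2 volume := by
    refine ⟨hf.aestronglyMeasurable, ?_⟩
    rw [eLpNorm_lt_top_iff_lintegral_rpow_enorm_lt_top (by norm_num) (by norm_num),
      lintegral_eq_sum_logChart (hf.enorm.pow_const _), ENNReal.sum_lt_top]
    intro σ _
    refine lt_of_le_of_lt (lintegral_mono fun u => ?_)
      ((eLpNorm_lt_top_iff_lintegral_rpow_enorm_lt_top (p := 2) (by norm_num)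
        (by norm_num)).1 (Lp.memLp (ψ σ)).2)
    rw [hv, enorm_mul, ENNReal.mul_rpow_of_nonneg _ _ (by norm_num), ← mul_assoc]
    -- The Jacobian `logDensity u ^ 2` cancels the square of the inverse half-density exactly.
    refine mul_le_of_le_one_left zero_le (le_of_eq ?_)
    have hp := logDensity_pos u
    rw [← ofReal_norm, norm_inv, Complex.norm_real, Real.norm_eq_abs, abs_of_pos hp,
      ENNReal.toReal_ofNat, ENNReal.rpow_ofNat, ← ENNReal.ofReal_pow (by positivity),
      ← ENNReal.ofReal_mul (by positivity), ← mul_pow, mul_inv_cancel₀ hp.ne']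
    simp
  refine ⟨hL.toLp f, fun σ => Lp.ext ?_⟩
  filter_upwards [(isWeight_logChart σ).pullback_coe (hL.toLp f),
    (isWeight_logChart σ).quasi.ae hL.coeFn_toLp] with u h1 h2
  rw [h1, h2, hv, ← mul_assoc]
  change ((logDensity u : ℝ) : ℂ) * _ * _ = _
  rw [mul_inv_cancel₀ (by exact_mod_cast (logDensity_pos u).ne'), one_mul]

theorem exists_mellin_eq {n : ℕ} (ψ : (Fin (n + 1) → ℤˣ) → Hil n) :
    ∃ Φ : Hil n, ∀ σ, mellin σ Φ = ψ σ := by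
  obtain ⟨Φ, hΦ⟩ := exists_pullback_eq fun σ => (Lp.fourierTransformₗᵢ (Space n) ℂ).symm (ψ σ)
  refine ⟨Φ, fun σ => ?_⟩
  simp [mellin, hΦ]

theorem mellin_ext {n : ℕ} {Φ Ψ : Hil n} (h : ∀ σ, mellin σ Φ = mellin σ Ψ) : Φ = Ψ :=
  sub_eq_zero.1 <| mellin_injective _ fun σ => by rw [map_sub, h, sub_self]

/-! ### Dilations in the spectral representation -/

/-- The vector `(a_μ p_μ)_μ`. -/
def scaled {n : ℕ} (a : Fin (n + 1) → ℝ) (p : Space n) : Space n :=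
  WithLp.toLp 2 fun μ => a μ * p μ

/-- The character `x ↦ exp (i ∑_μ p_μ x_μ)`. -/
def character {n : ℕ} (p x : Space n) : ℂ := Complex.exp (Complex.I * ((∑ μ, p μ * x μ : ℝ) : ℂ))

theorem norm_character {n : ℕ} (p x : Space n) : ‖character p x‖ = 1 := by
  rw [character, mul_comm, Complex.norm_exp_ofReal_mul_I]

theorem continuous_character {n : ℕ} :
    Continuous fun z : Space n × Space n => character z.1 z.2 := by
  unfold character
  fun_prop

theorem character_add {n : ℕ} (p p' x : Space n) :
    character (p + p') x = character p x * character p' x := by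
  simp only [character, ← Complex.exp_add, ← mul_add, ← Complex.ofReal_add]
  simp [add_mul, Finset.sum_add_distrib]

theorem character_zero {n : ℕ} (x : Space n) : character 0 x = 1 := by
  simp [character]

theorem continuous_spectralPoint {n : ℕ} (a : Fin (n + 1) → ℝ) :
    Continuous (spectralPoint a : Space n → Space n) := by
  unfold spectralPoint
  fun_prop

theorem fourier_comp_add_right_apply {n : ℕ} (h : Space n) (f : 𝓢(Space n, ℂ)) (ξ : Space n) :
    𝓕 (compSubConstCLM ℂ (-h) f) ξ =
      Complex.exp (Complex.I * ((∑ μ, h μ * (2 * Real.pi * ξ μ) : ℝ) : ℂ)) * 𝓕 f ξ := by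
  simp only [SchwartzMap.fourier_coe, Real.fourier_eq']
  rw [← integral_add_right_eq_self _ (-h), ← integral_const_mul]
  refine integral_congr_ae ?_
  filter_upwards with v
  simp only [compSubConstCLM_apply, smul_eq_mul, sub_neg_eq_add, neg_add_cancel_right]
  rw [← mul_assoc, ← Complex.exp_add]
  congr 2
  rw [inner_add_left, inner_neg_left]
  simp only [PiLp.inner_apply, RCLike.inner_apply, conj_trivial]
  push_cast
  simp only [mul_add, mul_neg, Finset.mul_sum]
  rw [add_mul, add_comm]
  congr 1
  rw [neg_mul, Finset.sum_mul, ← Finset.sum_neg_distrib]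
  exact Finset.sum_congr rfl fun μ _ => by ring

theorem fourierTransform_toLp {n : ℕ} (φ : 𝓢(Space n, ℂ)) :
    Lp.fourierTransformₗᵢ (Space n) ℂ (φ.toLp 2) = (𝓕 φ).toLp 2 :=
  SchwartzMap.toLp_fourier_eq φ

theorem exists_boundedMul {n : ℕ} {e : Space n → ℂ} {C : ℝ}
    (he : AEStronglyMeasurable e volume) (hC : ∀ ξ, ‖e ξ‖ ≤ C) :
    ∃ E : Hil n →L[ℂ] Hil n, ∀ f, E f =ᵐ[volume] fun ξ => e ξ * f ξ := by
  have h : MemLp e ⊤ volume := memLp_top_of_bound he C (ae_of_all _ hC)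
  refine ⟨(ContinuousLinearMap.mul ℂ ℂ).holderL volume ⊤ 2 2 (h.toLp e), fun f => ?_⟩
  filter_upwards [ContinuousLinearMap.coeFn_holder (ContinuousLinearMap.mul ℂ ℂ) (r := 2)
    (h.toLp e) f, h.coeFn_toLp] with ξ h1 h2
  change ContinuousLinearMap.holder 2 _ _ _ ξ = _
  rw [h1, h2]
  rfl

/-- On Schwartz functions this is a substitution in the Fourier integral. Translation `T`,
multiplication by the phase `E` and the Fourier transform `F` are bounded on `L²`, so the identity
`F T = E F` extends by density. -/
theorem fourier_translate {n : ℕ} (h : Space n) (f g : Hil n)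
    (hg : g =ᵐ[volume] fun u => f (u + h)) :
    Lp.fourierTransformₗᵢ (Space n) ℂ g =ᵐ[volume] fun ξ =>
      Complex.exp (Complex.I * ((∑ μ, h μ * (2 * Real.pi * ξ μ) : ℝ) : ℂ)) *
        Lp.fourierTransformₗᵢ (Space n) ℂ f ξ := by
  have hT : MeasurePreserving (fun u : Space n => u + h) volume volume :=
    measurePreserving_add_right volume h
  obtain ⟨T, hTf⟩ : ∃ T : Hil n →L[ℂ] Hil n, ∀ f, T f =ᵐ[volume] fun u => f (u + h) :=
    ⟨(Lp.compMeasurePreservingₗᵢ (p := 2) (E := ℂ) ℂ _ hT).toContinuousLinearMap,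
      fun f => Lp.coeFn_compMeasurePreserving f hT⟩
  obtain ⟨E, hE⟩ : ∃ E : Hil n →L[ℂ] Hil n, ∀ f, E f =ᵐ[volume] fun ξ =>
      Complex.exp (Complex.I * ((∑ μ, h μ * (2 * Real.pi * ξ μ) : ℝ) : ℂ)) * f ξ :=
    exists_boundedMul (by fun_prop) fun ξ => by rw [mul_comm, Complex.norm_exp_ofReal_mul_I]
  obtain ⟨F, hF⟩ : ∃ F : Hil n →L[ℂ] Hil n, ∀ f, F f = Lp.fourierTransformₗᵢ (Space n) ℂ f :=
    ⟨(Lp.fourierTransformₗᵢ (Space n) ℂ).toContinuousLinearEquiv.toContinuousLinearMap,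
      fun _ => rfl⟩
  have hφ : ∀ φ : 𝓢(Space n, ℂ), F (T (φ.toLp 2)) = E (F (φ.toLp 2)) := by
    intro φ
    have h1 : T (φ.toLp 2) = (compSubConstCLM ℂ (-h) φ).toLp 2 := by
      refine Lp.ext ?_
      filter_upwards [hTf (φ.toLp 2), (compSubConstCLM ℂ (-h) φ).coeFn_toLp 2 volume,
        hT.quasiMeasurePreserving.ae (φ.coeFn_toLp 2 volume)] with u h1 h2 h3
      rw [h1, h2, h3, compSubConstCLM_apply, sub_neg_eq_add]
    rw [h1, hF, hF, fourierTransform_toLp, fourierTransform_toLp]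
    refine Lp.ext ?_
    filter_upwards [hE ((𝓕 φ).toLp 2), (𝓕 φ).coeFn_toLp 2 volume,
      (𝓕 (compSubConstCLM ℂ (-h) φ)).coeFn_toLp 2 volume] with ξ h1 h2 h3
    rw [h1, h2, h3, fourier_comp_add_right_apply]
  have key : (fun f => F (T f)) = fun f => E (F f) :=
    (denseRange_toLpCLM (F := ℂ) (p := 2) (μ := (volume : Measure (Space n)))
      (by norm_num)).equalizer (F.continuous.comp T.continuous) (E.continuous.comp F.continuous)
      (funext hφ)
  have hgT : g = T f := Lp.ext (hg.trans (hTf f).symm)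
  rw [hgT, ← hF, congrFun key f, ← hF]
  exact hE _

theorem logChart_add_scaled {n : ℕ} (σ : Fin (n + 1) → ℤˣ) (s u : Space n) :
    diagMap (fun μ => Real.exp (s μ)) (logChart σ u) = logChart σ (u + s) := by
  ext μ
  simp only [diagMap_apply, logChart, PiLp.add_apply, Real.exp_add]
  ring

theorem expCoord_coe {n : ℕ} (a : Fin (n + 1) → ℝ) (p : Space n) (Φ : Hil n) :
    expCoord a p Φ =ᵐ[volume] fun x => (Real.exp (2⁻¹ * ∑ μ, a μ * p μ) : ℂ) *
      Φ (diagMap (fun μ => Real.exp (a μ * p μ)) x) :=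
  (isWeight_dilation (scaled a p)).pullback_coe Φ

/-- In logarithmic coordinates a dilation is a translation by `scaled a p`, and the two
half-densities multiply to that of the translated point: `e^{½∑u} e^{½∑ap} = e^{½∑(u+ap)}`. The
Fourier phase `(ap) · 2πξ` is `p` paired with the spectral value at `ξ`. -/
theorem mellin_expCoord {n : ℕ} (a : Fin (n + 1) → ℝ) (p : Space n) (Φ : Hil n)
    (σ : Fin (n + 1) → ℤˣ) :
    mellin σ (expCoord a p Φ) =ᵐ[volume]
      fun ξ => character p (spectralPoint a ξ) * mellin σ Φ ξ := by
  have h := fourier_translate (scaled a p) ((isWeight_logChart σ).pullback Φ)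
    ((isWeight_logChart σ).pullback (expCoord a p Φ)) ?_
  · refine h.trans ?_
    filter_upwards with ξ
    simp only [character, spectralPoint, scaled, mellin]
    congr 4
    exact Finset.sum_congr rfl fun μ _ => by ring
  · filter_upwards [(isWeight_logChart σ).pullback_coe (expCoord a p Φ),
      (isWeight_logChart σ).quasi.ae (expCoord_coe a p Φ),
      (measurePreserving_add_right volume (scaled a p)).quasiMeasurePreserving.ae
        ((isWeight_logChart σ).pullback_coe Φ)] with u h1 h2 h3
    rw [h1, h2, h3, ← logChart_add_scaled, ← mul_assoc, ← Complex.ofReal_mul, ← Real.exp_add]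
    simp only [PiLp.add_apply, Finset.sum_add_distrib, mul_add, scaled]

/-- The group laws are deduced from this: both sides are values of the same function of the
coordinates at the same vector. -/
theorem funGraph_right_unique {n : ℕ} {a : Fin (n + 1) → ℝ} {f : Space n → ℂ} {η ζ ζ' : Hil n}
    (h : (η, ζ) ∈ funGraph a f) (h' : (η, ζ') ∈ funGraph a f) : ζ = ζ' :=
  mellin_ext fun σ => Lp.ext ((h σ).trans (h' σ).symm)

theorem expCoord_mem_funGraph {n : ℕ} (a : Fin (n + 1) → ℝ) (p : Space n) (Φ : Hil n) :
    (Φ, expCoord a p Φ) ∈ funGraph a (character p) := fun σ => mellin_expCoord a p Φ σ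

theorem funOp_character {n : ℕ} (a : Fin (n + 1) → ℝ) (p : Space n) :
    funOp a (character p) = everywhere (expCoord a p) := by
  refine LinearPMap.eq_of_eq_graph ?_
  rw [funOp_graph]
  ext ⟨η, ζ⟩
  have h2 : (η, ζ) ∈ (everywhere (expCoord a p)).graph ↔ expCoord a p η = ζ := by
    simp [everywhere, LinearPMap.mem_graph_iff]
  rw [h2]
  exact ⟨fun h => funGraph_right_unique (expCoord_mem_funGraph a p η) h,
    fun h => h ▸ expCoord_mem_funGraph a p η⟩

theorem expCoord_zero {n : ℕ} (a : Fin (n + 1) → ℝ) : expCoord a 0 = LinearMap.id := by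
  refine LinearMap.ext fun Φ => funGraph_right_unique (expCoord_mem_funGraph a 0 Φ) fun σ => ?_
  filter_upwards with ξ
  simp [character_zero]

theorem expCoord_add_apply {n : ℕ} (a : Fin (n + 1) → ℝ) (p p' : Space n) (Φ : Hil n) :
    expCoord a (p + p') Φ = expCoord a p (expCoord a p' Φ) := by
  refine funGraph_right_unique (expCoord_mem_funGraph a (p + p') Φ) fun σ => ?_
  filter_upwards [mellin_expCoord a p (expCoord a p' Φ) σ, mellin_expCoord a p' Φ σ] with ξ h1 h2
  rw [h1, h2, character_add, mul_assoc]

theorem expCoord_neg_cancel {n : ℕ} (a : Fin (n + 1) → ℝ) (p : Space n) (Φ : Hil n) :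
    expCoord a p (expCoord a (-p) Φ) = Φ := by
  rw [← expCoord_add_apply, add_neg_cancel, expCoord_zero, LinearMap.id_apply]

theorem inner_expCoord {n : ℕ} (a : Fin (n + 1) → ℝ) (p : Space n) (Φ Ψ : Hil n) :
    ⟪expCoord a p Φ, expCoord a p Ψ⟫_ℂ = ⟪Φ, Ψ⟫_ℂ := by
  rw [inner_eq_sum_mellin, inner_eq_sum_mellin Φ]
  refine Finset.sum_congr rfl fun σ _ => ?_
  rw [L2.inner_def, L2.inner_def]
  refine integral_congr_ae ?_
  filter_upwards [mellin_expCoord a p Φ σ, mellin_expCoord a p Ψ σ] with ξ h1 h2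
  rw [h1, h2]
  have h3 : (starRingEnd ℂ) (character p (spectralPoint a ξ)) * character p (spectralPoint a ξ)
      = 1 := by
    rw [← Complex.normSq_eq_conj_mul_self, Complex.normSq_eq_norm_sq, norm_character]
    norm_num
  simp only [RCLike.inner_apply, map_mul]
  linear_combination ((starRingEnd ℂ) (mellin σ Φ ξ) * mellin σ Ψ ξ) * h3

theorem norm_expCoord {n : ℕ} (a : Fin (n + 1) → ℝ) (p : Space n) (Φ : Hil n) :
    ‖expCoord a p Φ‖ = ‖Φ‖ := by
  have h := inner_expCoord a p Φ Φ
  simp_rw [inner_self_eq_norm_sq_to_K] at h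
  have h' : ‖expCoord a p Φ‖ ^ 2 = ‖Φ‖ ^ 2 := by exact_mod_cast h
  exact (sq_eq_sq₀ (norm_nonneg _) (norm_nonneg _)).1 h'

theorem norm_sq_eq_integral {n : ℕ} (f : Hil n) : ‖f‖ ^ 2 = ∫ x, ‖f x‖ ^ 2 := by
  have h : ⟪f, f⟫_ℂ = ((∫ x, ‖f x‖ ^ 2 : ℝ) : ℂ) := by
    rw [L2.inner_def, ← integral_complex_ofReal]
    refine integral_congr_ae ?_
    filter_upwards with x
    rw [inner_self_eq_norm_sq_to_K]
    norm_cast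
  rw [inner_self_eq_norm_sq_to_K] at h
  refine Complex.ofReal_injective ?_
  rw [← h]
  simp

theorem integrable_norm_sq {n : ℕ} (f : Hil n) : Integrable fun x => ‖f x‖ ^ 2 :=
  (Lp.memLp f).integrable_norm_pow (by norm_num)

/-- Dominated convergence in `L²`. -/
theorem tendsto_of_dominated {n : ℕ} {ι : Type*} {l : Filter ι} [l.IsCountablyGenerated]
    {Z : ι → Hil n} {ζ : Hil n} {f : ι → Space n → ℂ} {f₀ : Space n → ℂ} {B : Space n → ℝ}
    (hZ : ∀ i, Z i =ᵐ[volume] f i) (hζ : ζ =ᵐ[volume] f₀) (hB : Integrable fun x => B x ^ 2)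
    (hle : ∀ᶠ i in l, ∀ x, ‖f i x - f₀ x‖ ≤ B x)
    (hlim : ∀ x, Tendsto (fun i => f i x) l (𝓝 (f₀ x))) : Tendsto Z l (𝓝 ζ) := by
  rw [tendsto_iff_norm_sub_tendsto_zero]
  suffices hs : Tendsto (fun i => ‖Z i - ζ‖ ^ 2) l (𝓝 0) by
    have := hs.sqrt
    simpa [Real.sqrt_sq (norm_nonneg _)] using this
  have h1 : ∀ i, (fun x => ‖(Z i - ζ : Hil n) x‖ ^ 2) =ᵐ[volume] fun x => ‖f i x - f₀ x‖ ^ 2 :=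
    fun i => by
      filter_upwards [Lp.coeFn_sub (Z i) ζ, hZ i, hζ] with x h1 h2 h3
      rw [h1, Pi.sub_apply, h2, h3]
  have h2 : ∀ i, ‖Z i - ζ‖ ^ 2 = ∫ x, ‖f i x - f₀ x‖ ^ 2 := fun i => by
    rw [norm_sq_eq_integral]
    exact integral_congr_ae (h1 i)
  simp_rw [h2]
  rw [show (0 : ℝ) = ∫ x : Space n, 0 by simp]
  refine tendsto_integral_filter_of_dominated_convergence (fun x => B x ^ 2) ?_ ?_ hB ?_
  · filter_upwards with i
    exact ((Lp.aestronglyMeasurable (Z i - ζ)).norm.pow 2).congr (h1 i)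
  · filter_upwards [hle] with i hi
    filter_upwards with x
    rw [norm_pow, norm_norm]
    gcongr
    exact hi x
  · filter_upwards with x
    have := ((hlim x).sub_const (f₀ x)).norm.pow 2
    simpa using this

theorem tendsto_of_mellin {n : ℕ} {ι : Type*} {l : Filter ι} {Z : ι → Hil n} {ζ : Hil n}
    (h : ∀ σ, Tendsto (fun i => mellin σ (Z i)) l (𝓝 (mellin σ ζ))) : Tendsto Z l (𝓝 ζ) := by
  rw [tendsto_iff_norm_sub_tendsto_zero]
  suffices hs : Tendsto (fun i => ‖Z i - ζ‖ ^ 2) l (𝓝 0) by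
    have := hs.sqrt
    simpa [Real.sqrt_sq (norm_nonneg _)] using this
  have h0 : ∀ i, ‖Z i - ζ‖ ^ 2 = ∑ σ, ‖mellin σ (Z i) - mellin σ ζ‖ ^ 2 := fun i => by
    rw [norm_sq_eq_sum_mellin]
    simp_rw [map_sub]
  simp_rw [h0]
  rw [show (0 : ℝ) = ∑ σ : Fin (n + 1) → ℤˣ, 0 by simp]
  refine tendsto_finsetSum _ fun σ _ => ?_
  simpa using ((h σ).sub_const (mellin σ ζ)).norm.pow 2

/-- Dominated convergence for bounded functions of the coordinates. -/
theorem tendsto_of_bounded_functions {n : ℕ} {a : Fin (n + 1) → ℝ} {ι : Type*} {l : Filter ι}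
    [l.IsCountablyGenerated] {Z : ι → Hil n} {ζ Φ : Hil n} {h : ι → Space n → ℂ}
    {h₀ : Space n → ℂ} {C : ℝ} (hZ : ∀ i, (Φ, Z i) ∈ funGraph a (h i))
    (hζ : (Φ, ζ) ∈ funGraph a h₀) (hC : ∀ i x, ‖h i x - h₀ x‖ ≤ C)
    (hlim : ∀ x, Tendsto (fun i => h i x) l (𝓝 (h₀ x))) : Tendsto Z l (𝓝 ζ) := by
  refine tendsto_of_mellin fun σ => tendsto_of_dominated (fun i => hZ i σ) (hζ σ)
    (B := fun ξ => C * ‖mellin σ Φ ξ‖) ?_ ?_ fun ξ => (hlim _).mul_const _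
  · simp_rw [mul_pow]
    exact (integrable_norm_sq _).const_mul _
  · filter_upwards with i ξ
    rw [← sub_mul, norm_mul]
    gcongr
    exact hC _ _

theorem continuous_expCoord {n : ℕ} (a : Fin (n + 1) → ℝ) (Φ : Hil n) :
    Continuous fun p => expCoord a p Φ := by
  refine continuous_iff_continuousAt.2 fun p => ?_
  refine tendsto_of_bounded_functions (fun p' => expCoord_mem_funGraph a p' Φ)
    (expCoord_mem_funGraph a p Φ) (C := 2) (fun p' x => ?_) fun x => ?_
  · refine (norm_sub_le _ _).trans ?_
    rw [norm_character, norm_character]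
    norm_num
  · exact (continuous_character.comp (continuous_id.prodMk continuous_const)).tendsto p

/-! ### The generators of the dilations -/

theorem momentum_apply {n : ℕ} (μ : Fin (n + 1)) (φ : 𝓢(Space n, ℂ)) (x : Space n) :
    momentum μ φ x = -Complex.I * fderiv ℝ φ x (EuclideanSpace.single μ 1) := by
  simp [momentum, lineDerivOp_apply_eq_fderiv]

theorem fderiv_position {n : ℕ} (μ ν : Fin (n + 1)) (φ : 𝓢(Space n, ℂ)) (x : Space n) :
    fderiv ℝ (position μ φ) x (EuclideanSpace.single ν 1) =
      (if μ = ν then φ x else 0) + x μ * fderiv ℝ φ x (EuclideanSpace.single ν 1) := by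
  have h1 : (position μ φ : Space n → ℂ) = fun x => (x μ : ℂ) * φ x :=
    funext (position_apply μ φ)
  have h2 : HasFDerivAt (fun x : Space n => ((x μ : ℝ) : ℂ))
      (Complex.ofRealCLM.comp (EuclideanSpace.proj (𝕜 := ℝ) μ)) x :=
    (Complex.ofRealCLM.comp (EuclideanSpace.proj (𝕜 := ℝ) μ)).hasFDerivAt
  rw [h1]
  change fderiv ℝ ((fun x : Space n => ((x μ : ℝ) : ℂ)) * ⇑φ) x _ = _
  rw [(h2.mul (φ.hasFDerivAt x)).fderiv]
  by_cases h : μ = ν <;> simp [h, add_comm]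

theorem coordOp_apply {n : ℕ} (a : Fin (n + 1) → ℝ) (μ : Fin (n + 1)) (φ : 𝓢(Space n, ℂ))
    (x : Space n) : Complex.I * coordOp a μ φ x =
      a μ * (2⁻¹ * φ x + x μ * fderiv ℝ φ x (EuclideanSpace.single μ 1)) := by
  have : coordOp a μ φ x = ((a μ / 2 : ℝ) : ℂ) *
      (position μ (momentum μ φ) x + momentum μ (position μ φ) x) := rfl
  rw [this, position_apply, momentum_apply, momentum_apply, fderiv_position, if_pos rfl]
  push_cast
  linear_combination (-a μ * (2⁻¹ * φ x + x μ * fderiv ℝ φ x (EuclideanSpace.single μ 1))) *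
    Complex.I_mul_I

/-- The inverse dilation has entries `e^{-s_μ} ≤ e^{‖s‖}`. Thus a dilation costs only an exponential
factor in the decay estimates, which fast weights can absorb. -/
theorem norm_le_exp_mul_norm_diagMap {n : ℕ} (s q : Space n) :
    ‖q‖ ≤ Real.exp ‖s‖ * ‖diagMap (fun μ => Real.exp (s μ)) q‖ := by
  rw [← abs_of_pos (Real.exp_pos ‖s‖), ← Real.norm_eq_abs, ← norm_smul]
  rw [EuclideanSpace.norm_eq, EuclideanSpace.norm_eq]
  refine Real.sqrt_le_sqrt (Finset.sum_le_sum fun μ _ => ?_)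
  gcongr
  rw [PiLp.smul_apply, diagMap_apply, smul_eq_mul, ← mul_assoc, norm_mul, ← Real.exp_add]
  refine le_mul_of_one_le_left (norm_nonneg _) ?_
  rw [Real.norm_eq_abs, Real.abs_exp, Real.one_le_exp_iff]
  have := (neg_le_abs _).trans (PiLp.norm_apply_le s μ)
  linarith

theorem schwartz_dilation_decay {n : ℕ} (ψ : 𝓢(Space n, ℂ)) (k : ℕ) :
    ∃ C, 0 ≤ C ∧ ∀ s q : Space n, (1 + ‖q‖) ^ k * ‖ψ (diagMap (fun μ => Real.exp (s μ)) q)‖ ≤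
      C * Real.exp (k * ‖s‖) := by
  obtain ⟨C, hC⟩ : ∃ C, ∀ x, (1 + ‖x‖) ^ k * ‖ψ x‖ ≤ C := ⟨_, fun x => by
    have h := one_add_le_sup_seminorm_apply (𝕜 := ℝ) (m := (k, 0)) (le_refl k) (le_refl 0) ψ x
    rwa [norm_iteratedFDeriv_zero] at h⟩
  refine ⟨C, (by positivity : 0 ≤ (1 + ‖(0 : Space n)‖) ^ k * ‖ψ 0‖).trans (hC 0), fun s q => ?_⟩
  have h1 : 1 + ‖q‖ ≤ Real.exp ‖s‖ * (1 + ‖diagMap (fun μ => Real.exp (s μ)) q‖) := by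
    rw [mul_add, mul_one]
    exact add_le_add (Real.one_le_exp (norm_nonneg _)) (norm_le_exp_mul_norm_diagMap s q)
  calc (1 + ‖q‖) ^ k * ‖ψ (diagMap (fun μ => Real.exp (s μ)) q)‖
      ≤ (Real.exp ‖s‖ * (1 + ‖diagMap (fun μ => Real.exp (s μ)) q‖)) ^ k *
        ‖ψ (diagMap (fun μ => Real.exp (s μ)) q)‖ := by gcongr
    _ = Real.exp (k * ‖s‖) * ((1 + ‖diagMap (fun μ => Real.exp (s μ)) q‖) ^ k *
        ‖ψ (diagMap (fun μ => Real.exp (s μ)) q)‖) := by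
      rw [mul_pow, Real.exp_nat_mul, mul_assoc]
    _ ≤ Real.exp (k * ‖s‖) * C := by gcongr; exact hC _
    _ = _ := mul_comm _ _

/-- The dilation of a function. -/
def dilate {n : ℕ} (a : Fin (n + 1) → ℝ) (p : Space n) (f : Space n → ℂ) (q : Space n) : ℂ :=
  (Real.exp (2⁻¹ * ∑ μ, a μ * p μ) : ℂ) * f (diagMap (fun μ => Real.exp (a μ * p μ)) q)

theorem expCoord_toLp_coe {n : ℕ} (a : Fin (n + 1) → ℝ) (p : Space n) (φ : 𝓢(Space n, ℂ)) :
    expCoord a p (φ.toLp 2) =ᵐ[volume] dilate a p φ := by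
  filter_upwards [expCoord_coe a p (φ.toLp 2),
    (isWeight_dilation (scaled a p)).quasi.ae (φ.coeFn_toLp 2 volume)] with x h1 h2
  rw [h1]
  exact congrArg _ h2

theorem norm_scaled_le {n : ℕ} (a : Fin (n + 1) → ℝ) : ∃ A, 0 ≤ A ∧ ∀ p : Space n,
    ‖scaled a p‖ ≤ A * ‖p‖ ∧ |2⁻¹ * ∑ μ, a μ * p μ| ≤ A * ‖p‖ := by
  have h1 : ∀ p : Space n, ‖scaled a p‖ ≤ ‖diagMap a‖ * ‖p‖ := fun p => by
    have : scaled a p = diagMap a p := by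
      ext μ
      rw [diagMap_apply, scaled]
    rw [this]
    exact (diagMap a).le_opNorm p
  have h2 : ∀ p : Space n, |2⁻¹ * ∑ μ, a μ * p μ| ≤ (2⁻¹ * ∑ μ, |a μ|) * ‖p‖ := fun p => by
    rw [abs_mul, abs_of_pos (by norm_num : (0 : ℝ) < 2⁻¹), mul_assoc, Finset.sum_mul]
    gcongr
    refine (Finset.abs_sum_le_sum_abs _ _).trans (Finset.sum_le_sum fun μ _ => ?_)
    rw [abs_mul]
    gcongr
    exact PiLp.norm_apply_le p μ
  have h3 : 0 ≤ 2⁻¹ * ∑ μ, |a μ| := by positivity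
  refine ⟨‖diagMap a‖ + 2⁻¹ * ∑ μ, |a μ|, by positivity, fun p => ⟨(h1 p).trans ?_,
    (h2 p).trans ?_⟩⟩ <;> gcongr <;> linarith [norm_nonneg (diagMap a)]

theorem dilate_decay {n : ℕ} (a : Fin (n + 1) → ℝ) (ψ : 𝓢(Space n, ℂ)) (k : ℕ) :
    ∃ C c, 0 ≤ C ∧ 0 ≤ c ∧ ∀ p q : Space n,
      (1 + ‖q‖) ^ k * ‖dilate a p ψ q‖ ≤ C * Real.exp (c * ‖p‖) := by
  obtain ⟨A, hA, hAp⟩ := norm_scaled_le a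
  obtain ⟨C, hC, h⟩ := schwartz_dilation_decay ψ k
  refine ⟨C, A + k * A, hC, by positivity, fun p q => ?_⟩
  have h1 := h (scaled a p) q
  have h2 : Real.exp (2⁻¹ * ∑ μ, a μ * p μ) ≤ Real.exp (A * ‖p‖) :=
    Real.exp_le_exp.2 ((le_abs_self _).trans (hAp p).2)
  have h3 : Real.exp (k * ‖scaled a p‖) ≤ Real.exp (k * (A * ‖p‖)) :=
    Real.exp_le_exp.2 (by gcongr; exact (hAp p).1)
  rw [dilate, norm_mul, Complex.norm_real, Real.norm_eq_abs, Real.abs_exp]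
  calc (1 + ‖q‖) ^ k * (Real.exp (2⁻¹ * ∑ μ, a μ * p μ) *
        ‖ψ (diagMap (fun μ => Real.exp (a μ * p μ)) q)‖)
      = Real.exp (2⁻¹ * ∑ μ, a μ * p μ) * ((1 + ‖q‖) ^ k *
        ‖ψ (diagMap (fun μ => Real.exp (scaled a p μ)) q)‖) := by
        simp only [scaled]; ring
    _ ≤ Real.exp (A * ‖p‖) * (C * Real.exp (k * (A * ‖p‖))) :=
        mul_le_mul h2 (h1.trans (by gcongr)) (by positivity) (by positivity)
    _ = C * Real.exp ((A + k * A) * ‖p‖) := by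
        rw [add_mul, Real.exp_add, mul_assoc (k : ℝ)]; ring

/-- Stated at every `s` and not only at `0`, so that the mean value inequality can be applied along
the orbit. -/
theorem hasDerivAt_dilate {n : ℕ} (a : Fin (n + 1) → ℝ) (μ : Fin (n + 1)) (φ : 𝓢(Space n, ℂ))
    (q : Space n) (s : ℝ) :
    HasDerivAt (fun s : ℝ => dilate a (EuclideanSpace.single μ s) φ q)
      (dilate a (EuclideanSpace.single μ s) (Complex.I • coordOp a μ φ : 𝓢(Space n, ℂ)) q) s := by
  have hsum : ∀ s : ℝ, ∑ ν, a ν * (EuclideanSpace.single μ s : Space n) ν = a μ * s := fun s => by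
    simp
  -- Only the `μ`-th coordinate moves, so the orbit of `q` runs along a line in the direction of the
  -- `μ`-th basis vector.
  have hcurve : ∀ s : ℝ, diagMap (fun ν => Real.exp (a ν * (EuclideanSpace.single μ s : Space n) ν)) q
      = q + ((Real.exp (a μ * s) - 1) * q μ) • EuclideanSpace.single μ (1 : ℝ) := fun s => by
    ext ν
    by_cases h : ν = μ
    · subst h
      simp [diagMap_apply]
      ring
    · simp [diagMap_apply, h]
  have h1 : HasDerivAt (fun s : ℝ => Real.exp (a μ * s)) (Real.exp (a μ * s) * (a μ * 1)) s :=
    ((hasDerivAt_id s).const_mul (a μ)).exp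
  have h2 : HasDerivAt (fun s : ℝ => Real.exp (2⁻¹ * (a μ * s)))
      (Real.exp (2⁻¹ * (a μ * s)) * (2⁻¹ * (a μ * 1))) s :=
    (((hasDerivAt_id s).const_mul (a μ)).const_mul 2⁻¹).exp
  have h3 : HasDerivAt
      (fun s : ℝ => q + ((Real.exp (a μ * s) - 1) * q μ) • EuclideanSpace.single μ (1 : ℝ))
      ((Real.exp (a μ * s) * (a μ * 1) * q μ) • EuclideanSpace.single μ (1 : ℝ)) s :=
    (((h1.sub_const 1).mul_const (q μ)).smul_const _).const_add q
  have h4 := h2.ofReal_comp.mul ((φ.hasFDerivAt _).comp_hasDerivAt s h3)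
  simp only [dilate, hsum, hcurve]
  refine HasDerivAt.congr_deriv h4 ?_
  have h5 : ∀ x, (Complex.I • coordOp a μ φ : 𝓢(Space n, ℂ)) x =
      a μ * (2⁻¹ * φ x + x μ * fderiv ℝ φ x (EuclideanSpace.single μ 1)) :=
    fun x => coordOp_apply a μ φ x
  rw [h5, map_smul, Complex.real_smul, Function.comp_apply]
  simp
  ring

theorem integrable_sq_inv_one_add_norm_pow {n : ℕ} (C : ℝ) :
    Integrable fun q : Space n => (C * ((1 + ‖q‖) ^ (n + 2))⁻¹) ^ 2 := by
  have h := integrable_one_add_norm (E := Space n) (μ := volume) (r := 2 * (n + 2))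
    (by simp; linarith)
  refine (h.const_mul (C ^ 2)).congr ?_
  filter_upwards with q
  have hq : 0 < 1 + ‖q‖ := by positivity
  rw [mul_pow, Real.rpow_neg hq.le, inv_pow, ← pow_mul]
  congr 2
  rw [← Real.rpow_natCast]
  congr 1
  push_cast
  ring

theorem expCoord_generator {n : ℕ} (a : Fin (n + 1) → ℝ) (μ : Fin (n + 1)) (φ : 𝓢(Space n, ℂ)) :
    HasDerivAt (fun s : ℝ => expCoord a (EuclideanSpace.single μ s) (φ.toLp 2 volume))
      (Complex.I • (coordOp a μ φ).toLp 2 volume) 0 := by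
  set ψ : 𝓢(Space n, ℂ) := Complex.I • coordOp a μ φ with hψ
  have hψL : Complex.I • (coordOp a μ φ).toLp 2 volume = ψ.toLp 2 volume := rfl
  rw [hψL, hasDerivAt_iff_tendsto_slope_zero]
  obtain ⟨C, c, hC, hc, hdec⟩ := dilate_decay a ψ (n + 2)
  have hs0 : ∀ f q, dilate a (EuclideanSpace.single μ 0) f q = f q := fun f q => by
    have : diagMap (fun _ => (1 : ℝ)) q = q := by
      ext ν
      simp [diagMap_apply]
    simp [dilate, this]
  -- A bound on the derivative, uniform for `|s| ≤ 1`. It is square integrable since `2 (n + 2) > n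
  -- + 1`.
  have hbd : ∀ s : ℝ, |s| ≤ 1 → ∀ q, ‖dilate a (EuclideanSpace.single μ s) ψ q‖ ≤
      C * Real.exp c * ((1 + ‖q‖) ^ (n + 2))⁻¹ := fun s hs q => by
    have h1 := hdec (EuclideanSpace.single μ s) q
    have h2 : Real.exp (c * ‖(EuclideanSpace.single μ s : Space n)‖) ≤ Real.exp c := by
      rw [Real.exp_le_exp, PiLp.norm_single, Real.norm_eq_abs]
      exact mul_le_of_le_one_right hc hs
    rw [← div_eq_mul_inv, le_div_iff₀ (by positivity), mul_comm]
    exact h1.trans (by gcongr)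
  refine tendsto_of_dominated
    (f := fun (t : ℝ) q => t⁻¹ • (dilate a (EuclideanSpace.single μ t) φ q - φ q))
    -- The difference quotient and its limit obey the same bound, hence the factor 2 for their
    -- difference.
    (B := fun q => 2 * (C * Real.exp c) * ((1 + ‖q‖) ^ (n + 2))⁻¹) ?_
    (ψ.coeFn_toLp 2 volume) (integrable_sq_inv_one_add_norm_pow _) ?_ ?_
  · intro t
    rw [zero_add]
    filter_upwards [Lp.coeFn_smul t⁻¹ (expCoord a (EuclideanSpace.single μ t) (φ.toLp 2 volume) -
      expCoord a (EuclideanSpace.single μ 0) (φ.toLp 2 volume)),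
      Lp.coeFn_sub (expCoord a (EuclideanSpace.single μ t) (φ.toLp 2 volume))
        (expCoord a (EuclideanSpace.single μ 0) (φ.toLp 2 volume)),
      expCoord_toLp_coe a (EuclideanSpace.single μ t) φ,
      expCoord_toLp_coe a (EuclideanSpace.single μ 0) φ] with q h1 h2 h3 h4
    rw [h1, Pi.smul_apply, h2, Pi.sub_apply, h3, h4, hs0]
  · have h1 : ∀ᶠ t : ℝ in 𝓝[≠] 0, |t| ≤ 1 := by
      refine nhdsWithin_le_nhds ?_
      filter_upwards [Metric.closedBall_mem_nhds (0 : ℝ) one_pos] with t ht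
      simpa using ht
    filter_upwards [h1, self_mem_nhdsWithin] with t ht ht0 q
    have h2 : ‖dilate a (EuclideanSpace.single μ t) φ q -
        dilate a (EuclideanSpace.single μ 0) φ q‖ ≤
        C * Real.exp c * ((1 + ‖q‖) ^ (n + 2))⁻¹ * ‖t - 0‖ :=
      (convex_closedBall (0 : ℝ) 1).norm_image_sub_le_of_norm_hasDerivWithin_le
        (fun s _ => (hasDerivAt_dilate a μ φ q s).hasDerivWithinAt)
        (fun s hs => hbd s (by simpa using hs) q) (by simp) (by simpa using ht)
    rw [hs0, sub_zero] at h2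
    have h3 : ‖ψ q‖ ≤ C * Real.exp c * ((1 + ‖q‖) ^ (n + 2))⁻¹ := by
      have := hbd 0 (by simp) q
      rwa [hs0] at this
    have h4 : ‖t⁻¹ • (dilate a (EuclideanSpace.single μ t) φ q - φ q)‖ ≤
        C * Real.exp c * ((1 + ‖q‖) ^ (n + 2))⁻¹ := by
      rw [norm_smul, norm_inv, inv_mul_le_iff₀ (norm_pos_iff.2 ht0), mul_comm]
      exact h2
    refine (norm_sub_le _ _).trans ?_
    linarith
  · intro q
    have h := hasDerivAt_dilate a μ φ q 0
    rw [hasDerivAt_iff_tendsto_slope_zero] at h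
    simpa only [zero_add, hs0] using h

theorem isExponentialOf_expCoord {n : ℕ} (a : Fin (n + 1) → ℝ) :
    IsExponentialOf (expCoord a) (coordOp a) where
  map_zero := expCoord_zero a
  map_add p p' := LinearMap.ext (expCoord_add_apply a p p')
  isometric := inner_expCoord a
  continuous := continuous_expCoord a
  generator := expCoord_generator a

/-! ### The oscillatory integral -/

/-- The Euclidean pairing `∑_μ x_μ y_μ`. -/
abbrev dot {n : ℕ} (x y : Space n) : ℝ := ∑ μ, x μ * y μ

theorem dot_eq_inner {n : ℕ} (x y : Space n) : dot x y = ⟪x, y⟫_ℝ := by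
  simp [dot, PiLp.inner_apply, mul_comm]

theorem abs_dot_le {n : ℕ} (x y : Space n) : |dot x y| ≤ ‖x‖ * ‖y‖ := by
  rw [dot_eq_inner]
  exact abs_real_inner_le_norm x y

theorem norm_exp_I_mul_ofReal (t : ℝ) : ‖Complex.exp (-Complex.I * (t : ℂ))‖ = 1 := by
  rw [show -Complex.I * (t : ℂ) = ((-t : ℝ) : ℂ) * Complex.I by push_cast; ring,
    Complex.norm_exp_ofReal_mul_I]

/-- The density of the spectral measure of the pair `Ψ, η`. -/
def spectralDensity {n : ℕ} (Ψ η : Hil n) (ξ : Space n) : ℂ :=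
  ∑ σ, ⟪mellin σ Ψ ξ, mellin σ η ξ⟫_ℂ

theorem spectralDensity_mul {n : ℕ} {a : Fin (n + 1) → ℝ} {f : Space n → ℂ} {η ζ : Hil n}
    (h : (η, ζ) ∈ funGraph a f) (Ψ : Hil n) :
    (fun ξ => ∑ σ, ⟪mellin σ Ψ ξ, mellin σ ζ ξ⟫_ℂ) =ᵐ[volume]
      fun ξ => spectralDensity Ψ η ξ * f (spectralPoint a ξ) := by
  filter_upwards [ae_all_iff.2 h] with ξ hξ
  rw [spectralDensity, Finset.sum_mul]
  refine Finset.sum_congr rfl fun σ _ => ?_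
  rw [hξ]
  simp only [RCLike.inner_apply]
  ring

theorem integrable_spectralDensity_mul {n : ℕ} {a : Fin (n + 1) → ℝ} {f : Space n → ℂ}
    {η ζ : Hil n} (h : (η, ζ) ∈ funGraph a f) (Ψ : Hil n) :
    Integrable fun ξ => spectralDensity Ψ η ξ * f (spectralPoint a ξ) :=
  (integrable_finsetSum _ fun σ _ => L2.integrable_inner (mellin σ Ψ) (mellin σ ζ)).congr
    (spectralDensity_mul h Ψ)

/-- For fixed `Ψ` and `η`, all the pairings of `Ψ` with vectors `f(X) η` become integrals of `f`
against one density. For unbounded `f`, convergence comes from `f(X) η` being in `L²`. -/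
theorem inner_eq_integral_spectralDensity {n : ℕ} {a : Fin (n + 1) → ℝ} {f : Space n → ℂ}
    {η ζ : Hil n} (h : (η, ζ) ∈ funGraph a f) (Ψ : Hil n) :
    ⟪Ψ, ζ⟫_ℂ = ∫ ξ, spectralDensity Ψ η ξ * f (spectralPoint a ξ) := by
  rw [← integral_congr_ae (spectralDensity_mul h Ψ), integral_finsetSum _ fun σ _ =>
    L2.integrable_inner (mellin σ Ψ) (mellin σ ζ), inner_eq_sum_mellin]
  rfl

theorem integrable_spectralDensity {n : ℕ} (Ψ η : Hil n) : Integrable (spectralDensity Ψ η) :=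
  integrable_finsetSum _ fun σ _ => L2.integrable_inner (mellin σ Ψ) (mellin σ η)

theorem integrable_exp_neg_norm {n : ℕ} : Integrable fun x : Space n => Real.exp (-‖x‖) := by
  have h := (integrable_one_add_norm (E := Space n) (μ := volume) (r := ((n + 2 : ℕ) : ℝ))
    (by simp)).const_mul (Real.exp 1 * (n + 2).factorial)
  refine h.mono' (by fun_prop) (ae_of_all _ fun x => ?_)
  have hx : 0 < 1 + ‖x‖ := by positivity
  have h1 := Real.pow_div_factorial_le_exp (1 + ‖x‖) hx.le (n + 2)
  rw [Real.norm_eq_abs, Real.abs_exp, Real.rpow_neg hx.le, Real.rpow_natCast, Real.exp_neg,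
    ← div_eq_mul_inv, le_div_iff₀ (by positivity), inv_mul_le_iff₀ (Real.exp_pos _)]
  rw [div_le_iff₀ (by positivity), Real.exp_add] at h1
  linarith

instance isAddHaarMeasure_prod {n : ℕ} :
    (volume : Measure (Space n × Space n)).IsAddHaarMeasure :=
  inferInstanceAs ((volume : Measure (Space n)).prod volume).IsAddHaarMeasure

/-- The exponential decay in `x` alone does not give integrability in `y`. The geometric mean of
that bound and a Schwartz bound handles both variables, so both are taken with doubled exponents;
`2n + 3` exceeds the dimension `2n + 2`. -/
theorem cutoff_integrable {n : ℕ} {χ : 𝓢(Space n × Space n, ℂ)} (hχ : IsCutoff χ) (v : Space n) :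
    Integrable (fun z : Space n × Space n => χ z * (Real.exp (dot v z.1) : ℂ)) volume := by
  obtain ⟨C, hC⟩ := hχ.decay (2 * ‖v‖)
  obtain ⟨D, hD⟩ : ∃ D, ∀ z, (1 + ‖z‖) ^ (2 * (2 * n + 3)) * ‖χ z‖ ≤ D := ⟨_, fun z => by
    have h := one_add_le_sup_seminorm_apply (𝕜 := ℝ) (m := (2 * (2 * n + 3), 0)) (le_refl _)
      (le_refl 0) χ z
    rwa [norm_iteratedFDeriv_zero] at h⟩
  have hC0 : 0 ≤ C := le_trans (by positivity) (hC 0 0)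
  have hD0 : 0 ≤ D := le_trans (by positivity) (hD 0)
  have h := (integrable_one_add_norm (E := Space n × Space n) (μ := volume)
    (r := ((2 * n + 3 : ℕ) : ℝ)) (by
      rw [Module.finrank_prod, finrank_euclideanSpace_fin]
      norm_cast
      omega)).const_mul (Real.sqrt (C * D))
  refine h.mono' (by
    refine (χ.continuous.mul ?_).aestronglyMeasurable
    fun_prop) (ae_of_all _ fun z => ?_)
  have hz : 0 < 1 + ‖z‖ := by positivity
  rw [norm_mul, Complex.norm_real, Real.norm_eq_abs, Real.abs_exp, Real.rpow_neg hz.le,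
    Real.rpow_natCast, ← div_eq_mul_inv, le_div_iff₀ (by positivity)]
  refine Real.le_sqrt_of_sq_le ?_
  have h1 := hC z.1 z.2
  have h2 := hD z
  have h3 : Real.exp (dot v z.1) ^ 2 ≤ Real.exp (2 * ‖v‖ * ‖z.1‖) := by
    rw [← Real.exp_nat_mul, Real.exp_le_exp, mul_assoc]
    have := (le_abs_self _).trans (abs_dot_le v z.1)
    push_cast
    linarith
  calc (‖χ z‖ * Real.exp (dot v z.1) * (1 + ‖z‖) ^ (2 * n + 3)) ^ 2
      = (Real.exp (dot v z.1) ^ 2 * ‖χ z‖) * ((1 + ‖z‖) ^ (2 * (2 * n + 3)) * ‖χ z‖) := by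
        rw [pow_mul', mul_pow, mul_pow]; ring
    _ ≤ (Real.exp (2 * ‖v‖ * ‖z.1‖) * ‖χ z‖) * ((1 + ‖z‖) ^ (2 * (2 * n + 3)) * ‖χ z‖) := by
        gcongr
    _ ≤ C * D := mul_le_mul h1 h2 (by positivity) hC0

theorem cutoff_integrable_smul {n : ℕ} {χ : 𝓢(Space n × Space n, ℂ)} (hχ : IsCutoff χ)
    (v : Space n) {ε : ℝ} (hε : 0 < ε) :
    Integrable (fun z : Space n × Space n => χ (ε • z) * (Real.exp (dot v z.1) : ℂ)) volume := by
  refine ((cutoff_integrable hχ (ε⁻¹ • v)).comp_smul hε.ne').congr (ae_of_all _ fun z => ?_)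
  have : dot (ε⁻¹ • v) (ε • z).1 = dot v z.1 := by
    refine Finset.sum_congr rfl fun μ _ => ?_
    simp only [PiLp.smul_apply, smul_eq_mul, Prod.smul_fst]
    field_simp
  simp only [this]

/-- The Fourier transform of a function of two variables in the second one. -/
def partialFourier {n : ℕ} (χ : 𝓢(Space n × Space n, ℂ)) (x ξ : Space n) : ℂ :=
  𝓕 (fun y => χ (x, y)) ξ

theorem exists_section_bound {n : ℕ} (χ : 𝓢(Space n × Space n, ℂ)) :
    ∃ B : Space n → ℝ, Integrable B ∧ ∀ x y, ‖χ (x, y)‖ ≤ B y := by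
  obtain ⟨D, hD⟩ : ∃ D, ∀ z, (1 + ‖z‖) ^ (n + 2) * ‖χ z‖ ≤ D := ⟨_, fun z => by
    have h := one_add_le_sup_seminorm_apply (𝕜 := ℝ) (m := (n + 2, 0)) (le_refl _)
      (le_refl 0) χ z
    rwa [norm_iteratedFDeriv_zero] at h⟩
  refine ⟨_, (integrable_one_add_norm (E := Space n) (μ := volume) (r := ((n + 2 : ℕ) : ℝ))
    (by simp)).const_mul D, fun x y => ?_⟩
  have hy : 0 < 1 + ‖y‖ := by positivity
  rw [Real.rpow_neg hy.le, Real.rpow_natCast, ← div_eq_mul_inv, le_div_iff₀ (by positivity),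
    mul_comm]
  refine le_trans ?_ (hD (x, y))
  gcongr
  exact norm_snd_le (x, y)

theorem continuous_partialFourier {n : ℕ} (χ : 𝓢(Space n × Space n, ℂ)) :
    Continuous fun z : Space n × Space n => partialFourier χ z.1 z.2 := by
  obtain ⟨B, hB, hle⟩ := exists_section_bound χ
  simp only [partialFourier, Real.fourier_eq']
  refine continuous_of_dominated (bound := B) (fun z => ?_) (fun z => ae_of_all _ fun y => ?_) hB
    (ae_of_all _ fun y => ?_)
  · have := χ.continuous
    exact Continuous.aestronglyMeasurable (by fun_prop)
  · rw [norm_smul, Complex.norm_exp_ofReal_mul_I, one_mul]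
    exact hle _ _
  · have := χ.continuous
    fun_prop

/-- Fourier inversion at the origin for `y ↦ χ (0, y)`. This value is the limit of the smoothing
kernel. -/
theorem integral_partialFourier_zero {n : ℕ} {χ : 𝓢(Space n × Space n, ℂ)} (hχ : IsCutoff χ) :
    ∫ ξ, partialFourier χ 0 ξ = 1 := by
  obtain ⟨B, hB, hle⟩ := exists_section_bound χ
  obtain ⟨C, hC⟩ := hχ.decay_fourier 1
  have hc : Continuous fun y => χ (0, y) := by
    have := χ.continuous
    fun_prop
  have h1 : Integrable (fun y => χ (0, y)) :=
    hB.mono' hc.aestronglyMeasurable (ae_of_all _ (hle 0))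
  have h2 : Integrable (𝓕 fun y => χ (0, y)) := by
    refine (integrable_exp_neg_norm.const_mul C).mono' ?_ (ae_of_all _ fun ξ => ?_)
    · exact ((continuous_partialFourier χ).comp
        (continuous_const.prodMk continuous_id)).aestronglyMeasurable
    · have := hC 0 ξ
      rw [one_mul, mul_comm] at this
      rwa [Real.exp_neg, ← div_eq_mul_inv, le_div_iff₀ (Real.exp_pos _)]
  have h3 := congrFun (hc.fourierInv_fourier_eq h1 h2) 0
  rw [Real.fourierInv_eq'] at h3
  have h4 : χ (0, 0) = 1 := hχ.one
  rw [h4] at h3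
  simpa [partialFourier] using h3

/-- The smoothing kernel, up to the factor `exp (v · s)`. -/
def kernel {n : ℕ} (χ : 𝓢(Space n × Space n, ℂ)) (v : Space n) (ε : ℝ) (s : Space n) : ℂ :=
  ∫ ξ, partialFourier χ (ε • s + (2 * Real.pi * ε ^ 2) • ξ) ξ *
    (Real.exp (2 * Real.pi * ε * dot v ξ) : ℂ)

theorem exists_kernel_bound {n : ℕ} {χ : 𝓢(Space n × Space n, ℂ)} (hχ : IsCutoff χ)
    (v : Space n) : ∃ B : Space n → ℝ, Integrable B ∧ ∀ ε, 0 < ε → ε ≤ 1 → ∀ s ξ,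
      ‖partialFourier χ (ε • s + (2 * Real.pi * ε ^ 2) • ξ) ξ *
        (Real.exp (2 * Real.pi * ε * dot v ξ) : ℂ)‖ ≤ B ξ := by
  -- The rate `2π‖v‖` pays for `exp (2πε v · ξ)` with `ε ≤ 1`; the extra `1` leaves the integrable
  -- `e^{-‖ξ‖}`. Uniformity in `s` is the uniformity of `decay_fourier` in the first variable.
  obtain ⟨C, hC⟩ := hχ.decay_fourier (2 * Real.pi * ‖v‖ + 1)
  refine ⟨_, integrable_exp_neg_norm.const_mul C, fun ε hε hε1 s ξ => ?_⟩
  have h1 := hC (ε • s + (2 * Real.pi * ε ^ 2) • ξ) ξ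
  have h2 : Real.exp (2 * Real.pi * ε * dot v ξ) ≤ Real.exp (2 * Real.pi * ‖v‖ * ‖ξ‖) := by
    have h3 : dot v ξ ≤ ‖v‖ * ‖ξ‖ := (le_abs_self _).trans (abs_dot_le v ξ)
    rw [Real.exp_le_exp]
    calc 2 * Real.pi * ε * dot v ξ ≤ 2 * Real.pi * ε * (‖v‖ * ‖ξ‖) := by gcongr
      _ ≤ 2 * Real.pi * 1 * (‖v‖ * ‖ξ‖) := by gcongr
      _ = _ := by ring
  rw [norm_mul, Complex.norm_real, Real.norm_eq_abs, Real.abs_exp, Real.exp_neg, ← div_eq_mul_inv,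
    le_div_iff₀ (Real.exp_pos _)]
  refine le_trans ?_ h1
  rw [add_mul, one_mul, Real.exp_add]
  calc _ ≤ ‖partialFourier χ (ε • s + (2 * Real.pi * ε ^ 2) • ξ) ξ‖ *
        Real.exp (2 * Real.pi * ‖v‖ * ‖ξ‖) * Real.exp ‖ξ‖ := by gcongr
    _ = _ := by rw [partialFourier]; ring

theorem continuous_kernel_integrand {n : ℕ} (χ : 𝓢(Space n × Space n, ℂ)) (v : Space n) :
    Continuous fun w : (ℝ × Space n) × Space n =>
      partialFourier χ (w.1.1 • w.1.2 + (2 * Real.pi * w.1.1 ^ 2) • w.2) w.2 *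
        (Real.exp (2 * Real.pi * w.1.1 * dot v w.2) : ℂ) := by
  have h1 : Continuous fun w : (ℝ × Space n) × Space n =>
      partialFourier χ (w.1.1 • w.1.2 + (2 * Real.pi * w.1.1 ^ 2) • w.2) w.2 :=
    (continuous_partialFourier χ).comp (f := fun w : (ℝ × Space n) × Space n =>
      (w.1.1 • w.1.2 + (2 * Real.pi * w.1.1 ^ 2) • w.2, w.2)) (by fun_prop)
  refine h1.mul ?_
  fun_prop

theorem continuous_kernel {n : ℕ} {χ : 𝓢(Space n × Space n, ℂ)} (hχ : IsCutoff χ)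
    (v : Space n) {ε : ℝ} (hε : 0 < ε) (hε1 : ε ≤ 1) : Continuous (kernel χ v ε) := by
  obtain ⟨B, hB, hle⟩ := exists_kernel_bound hχ v
  refine continuous_of_dominated (bound := B) (fun s => ?_)
    (fun s => ae_of_all _ (hle ε hε hε1 s)) hB (ae_of_all _ fun ξ => ?_)
  · exact ((continuous_kernel_integrand χ v).comp (f := fun ξ : Space n => ((ε, s), ξ))
      (by fun_prop)).aestronglyMeasurable
  · exact (continuous_kernel_integrand χ v).comp (f := fun s : Space n => ((ε, s), ξ))
      (by fun_prop)

theorem tendsto_kernel {n : ℕ} {χ : 𝓢(Space n × Space n, ℂ)} (hχ : IsCutoff χ)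
    (v s : Space n) : Tendsto (fun ε => kernel χ v ε s) (𝓝[>] 0) (𝓝 1) := by
  obtain ⟨B, hB, hle⟩ := exists_kernel_bound hχ v
  rw [← integral_partialFourier_zero hχ]
  refine tendsto_integral_filter_of_dominated_convergence B ?_ ?_ hB (ae_of_all _ fun ξ => ?_)
  · filter_upwards with ε
    exact ((continuous_kernel_integrand χ v).comp (f := fun ξ : Space n => ((ε, s), ξ))
      (by fun_prop)).aestronglyMeasurable
  · filter_upwards [Ioc_mem_nhdsGT (zero_lt_one' ℝ)] with ε hε
    exact ae_of_all _ (hle ε hε.1 hε.2 s)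
  · have h := ((continuous_kernel_integrand χ v).comp (f := fun ε : ℝ => ((ε, s), ξ))
      (by fun_prop)).tendsto 0
    refine (h.mono_left nhdsWithin_le_nhds).trans_eq ?_
    simp

theorem exists_norm_kernel_le {n : ℕ} {χ : 𝓢(Space n × Space n, ℂ)} (hχ : IsCutoff χ)
    (v : Space n) : ∃ C, ∀ ε, 0 < ε → ε ≤ 1 → ∀ s, ‖kernel χ v ε s‖ ≤ C := by
  obtain ⟨B, hB, hle⟩ := exists_kernel_bound hχ v
  exact ⟨_, fun ε hε hε1 s => norm_integral_le_of_norm_le hB (ae_of_all _ (hle ε hε hε1 s))⟩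

/-- The shift of `x` by `s` cancels the character and leaves the phase `-2πε ξ · y`. Replacing `εy`
by `y` makes it the Fourier phase, with Jacobian `ε^{-(n+1)}`. -/
theorem integral_cutoff_section {n : ℕ} (χ : 𝓢(Space n × Space n, ℂ)) {ε : ℝ} (hε : 0 < ε)
    (s ξ : Space n) :
    ∫ y, χ (ε • (s + (2 * Real.pi * ε) • ξ, y)) *
      Complex.exp (-Complex.I * (dot (s + (2 * Real.pi * ε) • ξ) y : ℂ)) * character y s =
    (((ε ^ (n + 1))⁻¹ : ℝ) : ℂ) * partialFourier χ (ε • s + (2 * Real.pi * ε ^ 2) • ξ) ξ := by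
  have h := Measure.integral_comp_smul_of_nonneg (volume : Measure (Space n))
    (fun y => Complex.exp (((-2 * Real.pi * ⟪y, ξ⟫_ℝ : ℝ) : ℂ) * Complex.I) •
      χ (ε • s + (2 * Real.pi * ε ^ 2) • ξ, y)) ε (hR := hε.le)
  rw [finrank_euclideanSpace_fin, Complex.real_smul] at h
  rw [partialFourier, Real.fourier_eq', ← h]
  refine integral_congr_ae (ae_of_all _ fun y => ?_)
  simp only [character, Prod.smul_mk, smul_add, smul_smul, smul_eq_mul]
  rw [mul_assoc, ← Complex.exp_add, mul_comm]
  congr 2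
  · rw [← dot_eq_inner, neg_mul, mul_comm Complex.I, mul_comm Complex.I, ← neg_mul, ← add_mul]
    rw [← Complex.ofReal_neg, ← Complex.ofReal_add]
    congr 2
    simp only [dot, PiLp.add_apply, PiLp.smul_apply, smul_eq_mul, Finset.mul_sum,
      ← Finset.sum_neg_distrib, ← Finset.sum_add_distrib]
    exact Finset.sum_congr rfl fun μ _ => by ring
  · rw [show ε * (2 * Real.pi * ε) = 2 * Real.pi * ε ^ 2 by ring]

/-- The substitution `x = s + 2πεξ` has Jacobian `(2πε)^{n+1}`; its powers of `ε` cancel those of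
the inner integral. The factor `e^{v·x}` splits into `e^{v·s}` and the factor `e^{2πε v·ξ}` of the
kernel. -/
theorem integral_cutoff_character {n : ℕ} {χ : 𝓢(Space n × Space n, ℂ)} (hχ : IsCutoff χ)
    (v : Space n) {ε : ℝ} (hε : 0 < ε) (s : Space n) :
    ∫ z : Space n × Space n, χ (ε • z) * (Real.exp (dot v z.1) : ℂ) *
      (Complex.exp (-Complex.I * (dot z.1 z.2 : ℂ)) * character z.2 s) =
    (((2 * Real.pi) ^ (n + 1) : ℝ) : ℂ) * ((Real.exp (dot v s) : ℂ) * kernel χ v ε s) := by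
  have hi : Integrable (fun z : Space n × Space n => χ (ε • z) * (Real.exp (dot v z.1) : ℂ) *
      (Complex.exp (-Complex.I * (dot z.1 z.2 : ℂ)) * character z.2 s)) volume := by
    refine (cutoff_integrable_smul hχ v hε).mul_bdd (c := 1) ?_ (ae_of_all _ fun z => ?_)
    · unfold character
      exact Continuous.aestronglyMeasurable (by fun_prop)
    · rw [norm_mul, norm_exp_I_mul_ofReal, norm_character, one_mul]
  rw [Measure.volume_eq_prod, integral_prod _ hi]
  have hc : 0 < 2 * Real.pi * ε := by positivity
  set g : Space n → ℂ := fun x => ∫ y, χ (ε • (x, y)) * (Real.exp (dot v x) : ℂ) *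
      (Complex.exp (-Complex.I * (dot x y : ℂ)) * character y s) with hg
  have h1 : ∫ x, g x = ∫ x, g (s + x) := (integral_add_left_eq_self g s).symm
  have h2 := Measure.integral_comp_smul_of_nonneg (volume : Measure (Space n))
    (fun x => g (s + x)) (2 * Real.pi * ε) (hR := hc.le)
  rw [finrank_euclideanSpace_fin] at h2
  have h3 : ∫ x, g (s + x) = ((2 * Real.pi * ε) ^ (n + 1)) •
      ∫ ξ, g (s + (2 * Real.pi * ε) • ξ) := by
    rw [h2, smul_inv_smul₀ (by positivity)]
  change ∫ x, g x = _
  rw [h1, h3, Complex.real_smul, kernel, ← integral_const_mul, ← integral_const_mul,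
    ← integral_const_mul]
  refine integral_congr_ae (ae_of_all _ fun ξ => ?_)
  have h4 : g (s + (2 * Real.pi * ε) • ξ) = (Real.exp (dot v (s + (2 * Real.pi * ε) • ξ)) : ℂ) *
      ((((ε ^ (n + 1))⁻¹ : ℝ) : ℂ) *
        partialFourier χ (ε • s + (2 * Real.pi * ε ^ 2) • ξ) ξ) := by
    rw [← integral_cutoff_section χ hε, ← integral_const_mul]
    refine integral_congr_ae (ae_of_all _ fun y => ?_)
    simp only
    ring
  have h5 : dot v (s + (2 * Real.pi * ε) • ξ) = dot v s + 2 * Real.pi * ε * dot v ξ := by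
    simp only [dot_eq_inner, inner_add_right, real_inner_smul_right]
  have h6 : (((2 * Real.pi * ε) ^ (n + 1) : ℝ) : ℂ) * (((ε ^ (n + 1))⁻¹ : ℝ) : ℂ) =
      (((2 * Real.pi) ^ (n + 1) : ℝ) : ℂ) := by
    rw [← Complex.ofReal_mul, mul_pow, mul_assoc, mul_inv_cancel₀ (by positivity), mul_one]
  simp only [h4]
  rw [h5, Real.exp_add, Complex.ofReal_mul, ← h6]
  ring

theorem integrable_oscillatory {n : ℕ} (a : Fin (n + 1) → ℝ) {χ : 𝓢(Space n × Space n, ℂ)}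
    (hχ : IsCutoff χ) (v : Space n) {ε : ℝ} (hε : 0 < ε) (Ψ η : Hil n) :
    Integrable (fun z : Space n × Space n => χ (ε • z) *
      Complex.exp (-Complex.I * (dot z.1 z.2 : ℂ)) *
        ((Real.exp (dot v z.1) : ℂ) * ⟪Ψ, expCoord a z.2 η⟫_ℂ)) volume := by
  have h : Integrable (fun z : Space n × Space n => χ (ε • z) * (Real.exp (dot v z.1) : ℂ) *
      (Complex.exp (-Complex.I * (dot z.1 z.2 : ℂ)) * ⟪Ψ, expCoord a z.2 η⟫_ℂ)) volume := by
    refine (cutoff_integrable_smul hχ v hε).mul_bdd (c := ‖Ψ‖ * ‖η‖) ?_ (ae_of_all _ fun z => ?_)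
    · refine Continuous.aestronglyMeasurable (Continuous.mul (by fun_prop) ?_)
      exact continuous_const.inner ((continuous_expCoord a η).comp continuous_snd)
    · rw [norm_mul, norm_exp_I_mul_ofReal, one_mul, ← norm_expCoord a z.2 η]
      exact norm_inner_le_norm _ _
  refine h.congr (ae_of_all _ fun z => ?_)
  simp only
  ring

/-- Fubini after inserting the spectral representation of `U(y) η`. The growing factor depends on
`x` only and is controlled by the cut-off, so the triple integrand is dominated by a product of
integrable functions. -/
theorem integral_oscillatory {n : ℕ} (a : Fin (n + 1) → ℝ) {χ : 𝓢(Space n × Space n, ℂ)}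
    (hχ : IsCutoff χ) (v : Space n) {ε : ℝ} (hε : 0 < ε) (Ψ η : Hil n) :
    ∫ z : Space n × Space n, χ (ε • z) * Complex.exp (-Complex.I * (dot z.1 z.2 : ℂ)) *
        ((Real.exp (dot v z.1) : ℂ) * ⟪Ψ, expCoord a z.2 η⟫_ℂ) =
      (((2 * Real.pi) ^ (n + 1) : ℝ) : ℂ) * ∫ ξ, spectralDensity Ψ η ξ *
        ((Real.exp (dot v (spectralPoint a ξ)) : ℂ) * kernel χ v ε (spectralPoint a ξ)) := by
  have hi : Integrable (Function.uncurry fun (z : Space n × Space n) (ξ : Space n) =>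
      (χ (ε • z) * (Real.exp (dot v z.1) : ℂ) * spectralDensity Ψ η ξ) *
      (Complex.exp (-Complex.I * (dot z.1 z.2 : ℂ)) * character z.2 (spectralPoint a ξ)))
      (volume.prod volume) := by
    refine ((cutoff_integrable_smul hχ v hε).mul_prod (integrable_spectralDensity Ψ η)).mul_bdd
      (c := 1) ?_ (ae_of_all _ fun w => ?_)
    · have := continuous_spectralPoint a
      refine Continuous.aestronglyMeasurable (Continuous.mul (by fun_prop) ?_)
      exact continuous_character.comp (f := fun w : (Space n × Space n) × Space n =>
        (w.1.2, spectralPoint a w.2)) (by fun_prop)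
    · rw [norm_mul, norm_exp_I_mul_ofReal, norm_character, one_mul]
  calc _ = ∫ z : Space n × Space n, ∫ ξ,
      (χ (ε • z) * (Real.exp (dot v z.1) : ℂ) * spectralDensity Ψ η ξ) *
      (Complex.exp (-Complex.I * (dot z.1 z.2 : ℂ)) * character z.2 (spectralPoint a ξ)) := by
        refine integral_congr_ae (ae_of_all _ fun z => ?_)
        simp only
        rw [inner_eq_integral_spectralDensity (expCoord_mem_funGraph a z.2 η) Ψ,
          ← integral_const_mul, ← integral_const_mul]
        refine integral_congr_ae (ae_of_all _ fun ξ => ?_)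
        simp only
        ring
    _ = _ := by
        rw [integral_integral_swap hi, ← integral_const_mul]
        refine integral_congr_ae (ae_of_all _ fun ξ => ?_)
        simp only
        rw [mul_left_comm, ← integral_cutoff_character hχ v hε, ← integral_const_mul]
        refine integral_congr_ae (ae_of_all _ fun z => ?_)
        simp only
        ring

/-- The warped convolution of `exp (v · x)` is `exp (v · X)`. -/
theorem tendsto_oscillatory {n : ℕ} {a : Fin (n + 1) → ℝ} {χ : 𝓢(Space n × Space n, ℂ)}
    (hχ : IsCutoff χ) {v : Space n} {η ζ : Hil n}
    (h : (η, ζ) ∈ funGraph a fun x => (Real.exp (dot v x) : ℂ)) (Ψ : Hil n) :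
    Tendsto (fun ε : ℝ => (((2 * Real.pi) ^ (n + 1) : ℝ) : ℂ)⁻¹ * ∫ z : Space n × Space n,
      χ (ε • z) * Complex.exp (-Complex.I * (dot z.1 z.2 : ℂ)) *
        ((Real.exp (dot v z.1) : ℂ) * ⟪Ψ, expCoord a z.2 η⟫_ℂ)) (𝓝[>] 0) (𝓝 ⟪Ψ, ζ⟫_ℂ) := by
  have hpi : (((2 * Real.pi) ^ (n + 1) : ℝ) : ℂ) ≠ 0 := by
    exact_mod_cast (by positivity : (2 * Real.pi) ^ (n + 1) ≠ 0)
  obtain ⟨C, hC⟩ := exists_norm_kernel_le hχ v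
  have hlim : Tendsto (fun ε : ℝ => ∫ ξ, spectralDensity Ψ η ξ *
      (Real.exp (dot v (spectralPoint a ξ)) : ℂ) * kernel χ v ε (spectralPoint a ξ)) (𝓝[>] 0)
      (𝓝 ⟪Ψ, ζ⟫_ℂ) := by
    rw [inner_eq_integral_spectralDensity h Ψ]
    -- The exponential is unbounded on the spectrum; its integrability against the density is where
    -- the membership of `η` in the domain of `exp (v · X)` enters.
    have hi := integrable_spectralDensity_mul h Ψ
    refine tendsto_integral_filter_of_dominated_convergence
      (fun ξ => ‖spectralDensity Ψ η ξ * (Real.exp (dot v (spectralPoint a ξ)) : ℂ)‖ * C) ?_ ?_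
      (hi.norm.mul_const C) (ae_of_all _ fun ξ => ?_)
    · filter_upwards [Ioc_mem_nhdsGT (zero_lt_one' ℝ)] with ε hε
      exact hi.aestronglyMeasurable.mul ((continuous_kernel hχ v hε.1 hε.2).comp
        (continuous_spectralPoint a)).aestronglyMeasurable
    · filter_upwards [Ioc_mem_nhdsGT (zero_lt_one' ℝ)] with ε hε
      refine ae_of_all _ fun ξ => ?_
      rw [norm_mul]
      gcongr
      exact hC ε hε.1 hε.2 _
    · simpa using (tendsto_kernel hχ v (spectralPoint a ξ)).const_mul
        (spectralDensity Ψ η ξ * (Real.exp (dot v (spectralPoint a ξ)) : ℂ))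
  refine hlim.congr' ?_
  filter_upwards [self_mem_nhdsWithin] with ε hε
  rw [integral_oscillatory a hχ v hε, inv_mul_cancel_left₀ hpi]
  simp_rw [mul_assoc]

/-! ### Differentials and dilations on Schwartz functions -/

theorem momentum_comm {n : ℕ} (μ ν : Fin (n + 1)) (φ : 𝓢(Space n, ℂ)) :
    momentum μ (momentum ν φ) = momentum ν (momentum μ φ) := by
  have h : ∀ μ ν x, momentum μ (momentum ν φ) x = -(fderiv ℝ (fderiv ℝ φ) x
      (EuclideanSpace.single μ 1) (EuclideanSpace.single ν 1)) := by
    intro μ ν x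
    have h1 : (momentum ν φ : Space n → ℂ) =
        fun x => -Complex.I * fderiv ℝ φ x (EuclideanSpace.single ν 1) :=
      funext (momentum_apply ν φ)
    have h2 : DifferentiableAt ℝ (fderiv ℝ φ) x :=
      ((φ.smooth 2).fderiv_right (m := 1) (by norm_num)).differentiable (by norm_num) x
    have h3 : HasFDerivAt (fun x => fderiv ℝ φ x (EuclideanSpace.single ν 1))
        ((fderiv ℝ (fderiv ℝ φ) x).flip (EuclideanSpace.single ν 1)) x :=
      (h2.hasFDerivAt.clm_apply (hasFDerivAt_const (EuclideanSpace.single ν (1 : ℝ)) x)).congr_fderiv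
        (by ext; simp)
    rw [momentum_apply, h1, (h3.const_mul (-Complex.I)).fderiv]
    simp only [smul_apply, ContinuousLinearMap.flip_apply, smul_eq_mul]
    rw [← mul_assoc, neg_mul_neg, Complex.I_mul_I, neg_one_mul]
  ext x
  rw [h, h, (φ.smooth 2).contDiffAt.isSymmSndFDerivAt (by simp)]

theorem momentum_position {n : ℕ} (μ ν : Fin (n + 1)) (φ : 𝓢(Space n, ℂ)) :
    momentum ν (position μ φ) =
      position μ (momentum ν φ) + (if μ = ν then -Complex.I else 0) • φ := by
  ext x
  rw [add_apply, smul_apply, momentum_apply, fderiv_position, position_apply, momentum_apply]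
  split_ifs <;> simp <;> ring

/-- `P^ν` commutes with `P^μ`, and `[P^ν, Q^μ] = -i δ_{μν}`; the two orderings in `X^μ` contribute
one half each. This makes the differentials multiples of the momenta. -/
theorem momentum_coordOp {n : ℕ} (a : Fin (n + 1) → ℝ) (μ ν : Fin (n + 1)) (φ : 𝓢(Space n, ℂ)) :
    momentum ν (coordOp a μ φ) - coordOp a μ (momentum ν φ) =
      (if μ = ν then -Complex.I * a μ else 0) • momentum μ φ := by
  have h : ∀ φ, coordOp a μ φ = ((a μ / 2 : ℝ) : ℂ) •
      (position μ (momentum μ φ) + momentum μ (position μ φ)) := fun _ => rfl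
  rw [h, h, map_smul, map_add, momentum_position μ ν, momentum_comm ν μ, momentum_comm ν μ,
    momentum_position μ ν, map_add, map_smul]
  split_ifs
  · push_cast
    module
  · simp

theorem diffOp_apply {n : ℕ} (a q : Fin (n + 1) → ℝ) (μ : Fin (n + 1)) (φ : 𝓢(Space n, ℂ)) :
    diffOp a q μ φ = ((q μ * a μ : ℝ) : ℂ) • momentum μ φ := by
  have h : diffOp a q μ φ = Complex.I • ∑ ν, ((q ν : ℝ) : ℂ) •
      (momentum ν (coordOp a μ φ) - coordOp a μ (momentum ν φ)) := by
    simp [diffOp, LinearMap.sum_apply]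
  simp_rw [h, momentum_coordOp]
  rw [Finset.sum_eq_single μ]
  · rw [if_pos rfl, smul_smul, smul_smul]
    congr 1
    push_cast
    linear_combination (-(q μ : ℂ) * a μ) * Complex.I_mul_I
  · intro ν _ hν
    rw [if_neg hν.symm, zero_smul, smul_zero]
  · exact fun h => absurd (Finset.mem_univ _) h

/-- The square of a represented differential. -/
abbrev diffSq {n : ℕ} (a q : Fin (n + 1) → ℝ) (μ : Fin (n + 1)) : Module.End ℂ 𝓢(Space n, ℂ) :=
  diffOp a q μ * diffOp a q μ

theorem diffSq_apply {n : ℕ} (a q : Fin (n + 1) → ℝ) (μ : Fin (n + 1)) (φ : 𝓢(Space n, ℂ)) :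
    diffSq a q μ φ = (((q μ * a μ) ^ 2 : ℝ) : ℂ) • momentum μ (momentum μ φ) := by
  rw [Module.End.mul_apply, diffOp_apply, diffOp_apply, map_smul, smul_smul]
  congr 1
  push_cast
  ring

/-- The diagonal linear map with entries `exp s`, as an equivalence. -/
def diagEquiv {n : ℕ} (s : Space n) : Space n ≃L[ℝ] Space n :=
  ContinuousLinearEquiv.equivOfInverse (diagMap fun μ => Real.exp (s μ))
    (diagMap fun μ => Real.exp (-s μ))
    (fun x => by ext μ; rw [diagMap_apply, diagMap_apply, ← mul_assoc, ← Real.exp_add]; simp)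
    (fun x => by ext μ; rw [diagMap_apply, diagMap_apply, ← mul_assoc, ← Real.exp_add]; simp)

/-- The dilation `U(p)` on Schwartz functions. -/
def schwartzDilation {n : ℕ} (a : Fin (n + 1) → ℝ) (p : Space n) : Module.End ℂ 𝓢(Space n, ℂ) :=
  (Real.exp (2⁻¹ * ∑ μ, a μ * p μ) : ℂ) •
    (compCLMOfContinuousLinearEquiv ℂ (diagEquiv (scaled a p))).toLinearMap

theorem schwartzDilation_apply {n : ℕ} (a : Fin (n + 1) → ℝ) (p : Space n) (φ : 𝓢(Space n, ℂ))
    (x : Space n) : schwartzDilation a p φ x = dilate a p φ x := rfl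

theorem toLp_schwartzDilation {n : ℕ} (a : Fin (n + 1) → ℝ) (p : Space n) (φ : 𝓢(Space n, ℂ)) :
    (schwartzDilation a p φ).toLp 2 volume = expCoord a p (φ.toLp 2 volume) := by
  refine Lp.ext ?_
  filter_upwards [expCoord_toLp_coe a p φ, (schwartzDilation a p φ).coeFn_toLp 2 volume]
    with x h1 h2
  rw [h1, h2, schwartzDilation_apply]

/-- The chain rule: the dilation stretches the `μ`-th basis vector by `e^{a_μ p_μ}`. Every
exponential factor of the deformed metric originates here. -/
theorem momentum_schwartzDilation {n : ℕ} (a : Fin (n + 1) → ℝ) (p : Space n) (μ : Fin (n + 1))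
    (φ : 𝓢(Space n, ℂ)) : momentum μ (schwartzDilation a p φ) =
      (Real.exp (a μ * p μ) : ℂ) • schwartzDilation a p (momentum μ φ) := by
  have hg : diagEquiv (scaled a p) (EuclideanSpace.single μ (1 : ℝ)) =
      Real.exp (a μ * p μ) • EuclideanSpace.single μ (1 : ℝ) := by
    ext ν
    change diagMap _ _ ν = _
    rw [diagMap_apply]
    by_cases h : ν = μ
    · subst h
      simp [scaled]
    · simp [h]
  ext x
  have h1 : momentum μ (schwartzDilation a p φ) = (-Complex.I) •
      (Real.exp (2⁻¹ * ∑ μ, a μ * p μ) : ℂ) • ∂_{EuclideanSpace.single μ (1 : ℝ)}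
        (compCLMOfContinuousLinearEquiv ℂ (diagEquiv (scaled a p)) φ) := by
    change (-Complex.I) • ∂_{EuclideanSpace.single μ (1 : ℝ)}
      ((Real.exp (2⁻¹ * ∑ μ, a μ * p μ) : ℂ) •
        compCLMOfContinuousLinearEquiv ℂ (diagEquiv (scaled a p)) φ) = _
    rw [LineDeriv.lineDerivOp_smul]
  have h2 : schwartzDilation a p (momentum μ φ) x = (Real.exp (2⁻¹ * ∑ μ, a μ * p μ) : ℂ) *
      momentum μ φ (diagEquiv (scaled a p) x) := rfl
  rw [h1, lineDerivOp_compCLMOfContinuousLinearEquiv, hg, LineDeriv.lineDerivOp_left_smul]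
  rw [smul_apply, smul_apply, smul_apply, h2, momentum_apply,
    compCLMOfContinuousLinearEquiv_apply, Function.comp_apply, smul_apply,
    lineDerivOp_apply_eq_fderiv]
  simp only [smul_eq_mul, Complex.real_smul]
  ring

theorem diffSq_schwartzDilation {n : ℕ} (a q : Fin (n + 1) → ℝ) (p : Space n) (μ : Fin (n + 1))
    (φ : 𝓢(Space n, ℂ)) : diffSq a q μ (schwartzDilation a p φ) =
      (Real.exp (2 * (a μ * p μ)) : ℂ) • schwartzDilation a p (diffSq a q μ φ) := by
  rw [diffSq_apply, diffSq_apply, momentum_schwartzDilation, map_smul, momentum_schwartzDilation,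
    map_smul, smul_smul, smul_smul, smul_smul, two_mul, Real.exp_add]
  congr 1
  push_cast
  ring

/-! ### Graphs of sums and compositions -/

/-- Described by graphs, natural domains need no separate bookkeeping: composition of operators is
composition of relations. -/
theorem mem_graph_pcomp {n : ℕ} {B A : Hil n →ₗ.[ℂ] Hil n} {Φ η : Hil n} :
    (Φ, η) ∈ (pcomp B A).graph ↔ ∃ ψ, (Φ, ψ) ∈ A.graph ∧ (ψ, η) ∈ B.graph := by
  constructor
  · intro h
    have hd := LinearPMap.mem_domain_of_mem_graph h
    obtain ⟨hA, hB⟩ := mem_pcomp_domain.1 hd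
    refine ⟨A ⟨Φ, hA⟩, A.mem_graph ⟨Φ, hA⟩, ?_⟩
    rw [(LinearPMap.image_iff hd).2 h, pcomp_apply hd hA hB]
    exact B.mem_graph ⟨_, hB⟩
  · rintro ⟨ψ, hA, hB⟩
    have hAd := LinearPMap.mem_domain_of_mem_graph hA
    have hψ := (LinearPMap.image_iff hAd).2 hA
    subst hψ
    have hBd := LinearPMap.mem_domain_of_mem_graph hB
    have hd : Φ ∈ (pcomp B A).domain := mem_pcomp_domain.2 ⟨hAd, hBd⟩
    rw [(LinearPMap.image_iff hBd).2 hB]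
    exact (pcomp B A).mem_graph ⟨Φ, hd⟩

theorem mem_graph_everywhere {n : ℕ} {T : Hil n →ₗ[ℂ] Hil n} {Φ η : Hil n} :
    (Φ, η) ∈ (everywhere T).graph ↔ T Φ = η := by
  simp [everywhere, LinearPMap.mem_graph_iff]

theorem mem_graph_funOp {n : ℕ} {a : Fin (n + 1) → ℝ} {f : Space n → ℂ} {Φ η : Hil n} :
    (Φ, η) ∈ (funOp a f).graph ↔ (Φ, η) ∈ funGraph a f := by
  rw [funOp_graph]

theorem mem_graph_schwartzOp {n : ℕ} {T : Module.End ℂ 𝓢(Space n, ℂ)} {Φ η : Hil n} :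
    (Φ, η) ∈ (schwartzOp T).graph ↔ ∃ φ : 𝓢(Space n, ℂ), φ.toLp 2 volume = Φ ∧ (T φ).toLp 2 volume = η := by
  rw [LinearPMap.mem_graph_iff]
  constructor
  · rintro ⟨⟨_, φ, rfl⟩, rfl, h⟩
    exact ⟨φ, rfl, (schwartzOp_apply T φ).symm.trans h⟩
  · rintro ⟨φ, rfl, rfl⟩
    exact ⟨⟨_, φ, rfl⟩, rfl, schwartzOp_apply T φ⟩

theorem mem_graph_add {n : ℕ} {A B : Hil n →ₗ.[ℂ] Hil n} {Φ η : Hil n} :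
    (Φ, η) ∈ (A + B).graph ↔ ∃ y z, (Φ, y) ∈ A.graph ∧ (Φ, z) ∈ B.graph ∧ η = y + z := by
  constructor
  · intro h
    have hd : Φ ∈ A.domain ⊓ B.domain := LinearPMap.mem_domain_of_mem_graph h
    refine ⟨A ⟨Φ, hd.1⟩, B ⟨Φ, hd.2⟩, A.mem_graph ⟨Φ, hd.1⟩, B.mem_graph ⟨Φ, hd.2⟩, ?_⟩
    rw [(LinearPMap.image_iff (LinearPMap.mem_domain_of_mem_graph h)).2 h]
    exact LinearPMap.add_apply A B ⟨Φ, hd⟩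
  · rintro ⟨y, z, hA, hB, rfl⟩
    have hAd := LinearPMap.mem_domain_of_mem_graph hA
    have hBd := LinearPMap.mem_domain_of_mem_graph hB
    rw [(LinearPMap.image_iff hAd).2 hA, (LinearPMap.image_iff hBd).2 hB]
    have h := (A + B).mem_graph ⟨Φ, hAd, hBd⟩
    rwa [LinearPMap.add_apply] at h

theorem mem_graph_sum {n : ℕ} {ι : Type*} (s : Finset ι) (A : ι → Hil n →ₗ.[ℂ] Hil n)
    {Φ η : Hil n} : (Φ, η) ∈ (∑ i ∈ s, A i).graph ↔
      ∃ y : ι → Hil n, (∀ i ∈ s, (Φ, y i) ∈ (A i).graph) ∧ η = ∑ i ∈ s, y i := by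
  classical
  induction s using Finset.induction_on generalizing η with
  | empty =>
    simp only [Finset.sum_empty, Finset.notMem_empty, false_implies, implies_true, true_and,
      exists_const]
    constructor
    · intro h
      exact (LinearPMap.image_iff (LinearPMap.mem_domain_of_mem_graph h)).2 h
    · rintro rfl
      exact (0 : Hil n →ₗ.[ℂ] Hil n).mem_graph ⟨Φ, trivial⟩
  | insert i s hi ih =>
    rw [Finset.sum_insert hi, mem_graph_add]
    constructor
    · rintro ⟨y, z, hy, hz, rfl⟩
      obtain ⟨w, hw, rfl⟩ := ih.1 hz
      have hne : ∀ j ∈ s, Function.update w i y j = w j := fun j hj =>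
        Function.update_of_ne (by rintro rfl; exact hi hj) _ _
      refine ⟨Function.update w i y, fun j hj => ?_, ?_⟩
      · rcases Finset.mem_insert.1 hj with rfl | hj
        · simpa using hy
        · rw [hne j hj]
          exact hw j hj
      · rw [Finset.sum_insert hi, Finset.sum_congr rfl hne, Function.update_self]
    · rintro ⟨y, hy, rfl⟩
      exact ⟨y i, _, hy i (Finset.mem_insert_self i s),
        ih.2 ⟨y, fun j hj => hy j (Finset.mem_insert_of_mem hj), rfl⟩, Finset.sum_insert hi⟩

/-! ### The line-element of a diagonal metric -/

theorem mem_funGraph_zero {n : ℕ} {a : Fin (n + 1) → ℝ} {η ζ : Hil n} :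
    (η, ζ) ∈ funGraph a (fun _ => 0) ↔ ζ = 0 := by
  have h0 : (η, (0 : Hil n)) ∈ funGraph a (fun _ => 0) := fun σ => by
    rw [map_zero]
    filter_upwards [Lp.coeFn_zero ℂ 2 (volume : Measure (Space n))] with ξ h
    rw [h]
    simp
  exact ⟨fun h => funGraph_right_unique h h0, fun h => h ▸ h0⟩

/-- The diagonal components of a metric `N dt² - ∑_i s_i² (dx^i)²`. -/
def metricDiag {n : ℕ} (N : Space n → ℝ) (s : Fin n → ℝ → ℝ) (μ : Fin (n + 1)) (x : Space n) : ℝ :=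
  (Fin.cons (N x) fun i => -(s i (x 0)) ^ 2 : Fin (n + 1) → ℝ) μ

/-- The off-diagonal terms carry the function `0` of the coordinates, which is defined everywhere,
so they neither shrink the domain nor change the value. -/
theorem mem_graph_lineElement {n : ℕ} {a q : Fin (n + 1) → ℝ} {N : Space n → ℝ}
    {s : Fin n → ℝ → ℝ} {Φ η : Hil n} :
    (Φ, η) ∈ (lineElement a q (metric N s)).graph ↔ ∃ φ : 𝓢(Space n, ℂ), φ.toLp 2 volume = Φ ∧
      ∃ y : Fin (n + 1) → Hil n, (∀ μ, ((diffSq a q μ φ).toLp 2 volume, y μ) ∈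
        funGraph a fun x => ((metricDiag N s μ x : ℝ) : ℂ)) ∧ η = ∑ μ, y μ := by
  have hdiag : ∀ μ, (fun x => ((metric N s x μ μ : ℝ) : ℂ)) =
      fun x => ((metricDiag N s μ x : ℝ) : ℂ) := fun μ => by
    funext x
    rw [metric, Matrix.diagonal_apply_eq, metricDiag]
  have hoff : ∀ μ ν, μ ≠ ν → (fun x => ((metric N s x μ ν : ℝ) : ℂ)) = fun _ => 0 := by
    intro μ ν h
    funext x
    rw [metric, Matrix.diagonal_apply_ne _ h, Complex.ofReal_zero]
  have hterm : ∀ μ ν y, (Φ, y) ∈ (pcomp (funOp a fun x => ((metric N s x μ ν : ℝ) : ℂ))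
      (schwartzOp (diffOp a q μ * diffOp a q ν))).graph ↔ ∃ φ : 𝓢(Space n, ℂ), φ.toLp 2 volume = Φ ∧
        (((diffOp a q μ * diffOp a q ν) φ).toLp 2 volume, y) ∈
          funGraph a fun x => ((metric N s x μ ν : ℝ) : ℂ) := by
    intro μ ν y
    rw [mem_graph_pcomp]
    constructor
    · rintro ⟨ψ, h1, h2⟩
      obtain ⟨φ, h3, rfl⟩ := mem_graph_schwartzOp.1 h1
      exact ⟨φ, h3, mem_graph_funOp.1 h2⟩
    · rintro ⟨φ, h1, h2⟩
      exact ⟨_, mem_graph_schwartzOp.2 ⟨φ, h1, rfl⟩, mem_graph_funOp.2 h2⟩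
  rw [lineElement, mem_graph_sum]
  constructor
  · rintro ⟨y, hy, rfl⟩
    have hy' := fun μ => (mem_graph_sum _ _).1 (hy μ (Finset.mem_univ μ))
    choose z hz hyz using hy'
    have hz' := fun μ ν => (hterm μ ν _).1 (hz μ ν (Finset.mem_univ ν))
    -- Each term supplies its own Schwartz representative of `Φ`; by injectivity of the embedding
    -- into `L²` they all equal this one.
    obtain ⟨φ, hφ, -⟩ := hz' 0 0
    have hall : ∀ μ ν, (((diffOp a q μ * diffOp a q ν) φ).toLp 2 volume, z μ ν) ∈
          funGraph a fun x => ((metric N s x μ ν : ℝ) : ℂ) := fun μ ν => by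
      obtain ⟨φ', hφ', h⟩ := hz' μ ν
      rwa [injective_toLp 2 volume (hφ'.trans hφ.symm)] at h
    refine ⟨φ, hφ, fun μ => z μ μ, fun μ => hdiag μ ▸ hall μ μ, Finset.sum_congr rfl fun μ _ => ?_⟩
    rw [hyz, Finset.sum_eq_single μ]
    · intro ν _ hν
      have h := hall μ ν
      rwa [hoff μ ν hν.symm, mem_funGraph_zero] at h
    · exact fun h => absurd (Finset.mem_univ _) h
  · rintro ⟨φ, hφ, y, hy, rfl⟩
    refine ⟨y, fun μ _ => ?_, rfl⟩
    rw [mem_graph_sum]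
    refine ⟨fun ν => if ν = μ then y μ else 0, fun ν _ => ?_, by simp⟩
    rw [hterm]
    refine ⟨φ, hφ, ?_⟩
    by_cases h : ν = μ
    · subst h
      simp only [if_true, hdiag]
      exact hy ν
    · simp only [if_neg h, hoff μ ν (Ne.symm h), mem_funGraph_zero]

/-! ### The deformed line-element -/

theorem expCoord_mem_funGraph_of_mem {n : ℕ} {a : Fin (n + 1) → ℝ} {f : Space n → ℂ} {η ζ : Hil n}
    (h : (η, ζ) ∈ funGraph a f) (p : Space n) :
    (expCoord a p η, expCoord a p ζ) ∈ funGraph a f := fun σ => by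
  filter_upwards [h σ, mellin_expCoord a p η σ, mellin_expCoord a p ζ σ] with ξ h1 h2 h3
  rw [h3, h2, h1, mul_left_comm]

/-- If `f(X)` and `(k f)(X)` are both defined at `ψ`, then `f(X) ψ` is in the domain of `k(X)`,
however fast `k` grows. -/
theorem funGraph_of_mul {n : ℕ} {a : Fin (n + 1) → ℝ} {f g k : Space n → ℂ} {ψ η ζ : Hil n}
    (hf : (ψ, η) ∈ funGraph a f) (hg : (ψ, ζ) ∈ funGraph a g) (hk : ∀ x, g x = k x * f x) :
    (η, ζ) ∈ funGraph a k := fun σ => by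
  filter_upwards [hf σ, hg σ] with ξ h1 h2
  rw [h1, h2, hk, mul_assoc]

theorem mem_graph_adjointAction {n : ℕ} {a : Fin (n + 1) → ℝ} {p : Space n}
    {A : Hil n →ₗ.[ℂ] Hil n} {Φ w : Hil n} (h : (expCoord a (-p) Φ, w) ∈ A.graph) :
    (Φ, expCoord a p w) ∈ (adjointAction a p A).graph :=
  mem_graph_pcomp.2 ⟨w, mem_graph_pcomp.2 ⟨_, mem_graph_everywhere.2 rfl, h⟩,
    mem_graph_everywhere.2 rfl⟩

/-- `U(-p) φ` is again Schwartz, and moving `U(-p)` to the left through `(dX^μ)²` gives `e^{-2 a_μ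
p_μ}`. It commutes with the metric component and is then cancelled by `U(p)`. -/
theorem mem_graph_adjointAction_lineElement {n : ℕ} {a q : Fin (n + 1) → ℝ} {N : Space n → ℝ}
    {s : Fin n → ℝ → ℝ} {φ : 𝓢(Space n, ℂ)} {y : Fin (n + 1) → Hil n}
    (hy : ∀ μ, ((diffSq a q μ φ).toLp 2 volume, y μ) ∈ funGraph a fun x => ((metricDiag N s μ x : ℝ) : ℂ))
    (p : Space n) : (φ.toLp 2 volume, ∑ μ, (Real.exp (-2 * (a μ * p μ)) : ℂ) • y μ) ∈
      (adjointAction a p (lineElement a q (metric N s))).graph := by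
  have h1 : (expCoord a (-p) (φ.toLp 2 volume),
      ∑ μ, (Real.exp (-2 * (a μ * p μ)) : ℂ) • expCoord a (-p) (y μ)) ∈
      (lineElement a q (metric N s)).graph := by
    refine mem_graph_lineElement.2 ⟨schwartzDilation a (-p) φ, toLp_schwartzDilation a (-p) φ, _,
      fun μ => ?_, rfl⟩
    rw [diffSq_schwartzDilation]
    have h2 : ((Real.exp (2 * (a μ * (-p) μ)) : ℂ) •
        schwartzDilation a (-p) (diffSq a q μ φ)).toLp 2 volume =
        (Real.exp (-2 * (a μ * p μ)) : ℂ) • expCoord a (-p) ((diffSq a q μ φ).toLp 2 volume) := by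
      rw [← toLp_schwartzDilation, PiLp.neg_apply, mul_neg, mul_neg, neg_mul]
      rfl
    rw [h2]
    exact Submodule.smul_mem _ _ (expCoord_mem_funGraph_of_mem (hy μ) (-p))
  have h3 := mem_graph_adjointAction h1
  simp_rw [map_sum, map_smul, expCoord_neg_cancel] at h3
  exact h3

/-- If `α_{Θx}(A) Φ` is a finite sum of vectors `exp (v_i · x) y_i`, then `A_Θ Φ` is the sum of the
vectors `exp (v_i · X) y_i`. -/
theorem hasWarpedConvolution_of_sum {n : ℕ} {ι : Type*} [Fintype ι] {a : Fin (n + 1) → ℝ}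
    {Θ : Matrix (Fin (n + 1)) (Fin (n + 1)) ℝ} {A : Hil n →ₗ.[ℂ] Hil n} {Φ : Hil n}
    {v : ι → Space n} {y y' : ι → Hil n}
    (hA : ∀ x, (Φ, ∑ i, (Real.exp (dot (v i) x) : ℂ) • y i) ∈
      (adjointAction a (thetaVec Θ x) A).graph)
    (hexp : ∀ i, (y i, y' i) ∈ funGraph a fun x => (Real.exp (dot (v i) x) : ℂ)) :
    HasWarpedConvolution a Θ A Φ (∑ i, y' i) := by
  refine ⟨fun x => LinearPMap.mem_domain_of_mem_graph (hA x), fun χ hχ Ψ => ?_⟩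
  intro F
  have hF : ∀ ε, F ε = fun z => ∑ i, χ (ε • z) * Complex.exp (-Complex.I * (dot z.1 z.2 : ℂ)) *
        ((Real.exp (dot (v i) z.1) : ℂ) * ⟪Ψ, expCoord a z.2 (y i)⟫_ℂ) := fun ε => by
    funext z
    have hval := (LinearPMap.image_iff (LinearPMap.mem_domain_of_mem_graph (hA z.1))).2 (hA z.1)
    simp only [F]
    rw [← hval, map_sum, inner_sum, Finset.mul_sum]
    refine Finset.sum_congr rfl fun i _ => ?_
    rw [LinearMap.map_smul, inner_smul_right]
  have hint : ∀ ε : ℝ, 0 < ε → ∀ i, Integrable (fun z : Space n × Space n => χ (ε • z) *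
      Complex.exp (-Complex.I * (dot z.1 z.2 : ℂ)) *
        ((Real.exp (dot (v i) z.1) : ℂ) * ⟪Ψ, expCoord a z.2 (y i)⟫_ℂ)) volume :=
    fun ε hε i => integrable_oscillatory a hχ (v i) hε Ψ (y i)
  clear_value F
  obtain rfl : F = _ := funext hF
  refine ⟨fun ε hε => integrable_finsetSum _ fun i _ => hint ε hε i, ?_⟩
  rw [inner_sum]
  refine (tendsto_finsetSum _ fun i _ => tendsto_oscillatory hχ (hexp i) Ψ).congr' ?_
  filter_upwards [self_mem_nhdsWithin] with ε hε
  rw [integral_finsetSum _ fun i _ => hint ε hε i, Finset.mul_sum]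

/-- If the components of the second metric are `exp (v_μ · x)` times those of the first one, and
the conjugation by `U(Θ x)` multiplies `(dX^μ)²` by `exp (v_μ · x)`, then the second line-element
is the deformation of the first one. -/
theorem hasWarpedConvolution_lineElement {n : ℕ} {a q : Fin (n + 1) → ℝ}
    {Θ : Matrix (Fin (n + 1)) (Fin (n + 1)) ℝ} {N N' : Space n → ℝ} {s s' : Fin n → ℝ → ℝ}
    {v : Fin (n + 1) → Space n}
    (hv : ∀ μ x, metricDiag N' s' μ x = Real.exp (dot (v μ) x) * metricDiag N s μ x)
    (hΘ : ∀ μ x, -2 * (a μ * thetaVec Θ x μ) = dot (v μ) x) {Φ η η' : Hil n}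
    (h : (Φ, η) ∈ (lineElement a q (metric N s)).graph)
    (h' : (Φ, η') ∈ (lineElement a q (metric N' s')).graph) :
    HasWarpedConvolution a Θ (lineElement a q (metric N s)) Φ η' := by
  obtain ⟨φ, rfl, y, hy, -⟩ := mem_graph_lineElement.1 h
  obtain ⟨φ', hφ', y', hy', rfl⟩ := mem_graph_lineElement.1 h'
  obtain rfl := injective_toLp 2 volume hφ'
  -- Both vectors are functions of the coordinates applied to the same `(dX^μ)² Φ`, and these
  -- functions differ by the factor `exp (v_μ · x)`.
  have hexp : ∀ μ, (y μ, y' μ) ∈ funGraph a fun x => (Real.exp (dot (v μ) x) : ℂ) := fun μ =>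
    funGraph_of_mul (hy μ) (hy' μ) fun x => by rw [hv, Complex.ofReal_mul]
  have hadj := fun x => mem_graph_adjointAction_lineElement hy (thetaVec Θ x)
  simp_rw [hΘ] at hadj
  exact hasWarpedConvolution_of_sum hadj hexp

/-! ### A criterion for Schwartz functions -/

/-- The `μ`-th coordinate as a complex-valued real-linear functional. -/
def coordFunctional {n : ℕ} (μ : Fin (n + 1)) : Space n →L[ℝ] ℂ :=
  Complex.ofRealCLM.comp (EuclideanSpace.proj (𝕜 := ℝ) μ)

theorem coordFunctional_apply {n : ℕ} (μ : Fin (n + 1)) (x : Space n) :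
    coordFunctional μ x = (x μ : ℂ) := rfl

/-- A set of rapidly decreasing functions which is stable under partial derivatives consists of
Schwartz functions. -/
theorem exists_schwartzMap_of_stable {n : ℕ} {S : Set (Space n → ℂ)}
    (hder : ∀ F ∈ S, ∃ G : Fin (n + 1) → Space n → ℂ, (∀ μ, G μ ∈ S) ∧
      ∀ q, HasFDerivAt F (∑ μ, G μ q • coordFunctional μ) q)
    (hdec : ∀ F ∈ S, ∀ k : ℕ, ∃ C, ∀ q, ‖q‖ ^ k * ‖F q‖ ≤ C) {F : Space n → ℂ} (hF : F ∈ S) :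
    ∃ φ : 𝓢(Space n, ℂ), ⇑φ = F := by
  -- The derivative of `F` is a sum of fixed linear images of the `G μ`, so its derivatives of order
  -- `m + 1` are controlled by those of order `m` of members of `S`.
  let T : Fin (n + 1) → ℂ →L[ℝ] (Space n →L[ℝ] ℂ) := fun μ =>
    (ContinuousLinearMap.id ℝ ℂ).smulRight (coordFunctional μ)
  have hstep : ∀ F ∈ S, ∃ G : Fin (n + 1) → Space n → ℂ, (∀ μ, G μ ∈ S) ∧
      (∀ q, HasFDerivAt F (∑ μ, T μ (G μ q)) q) := hder
  have key : ∀ m : ℕ, ∀ F ∈ S, ContDiff ℝ m F ∧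
      ∀ k : ℕ, ∃ C, ∀ q, ‖q‖ ^ k * ‖iteratedFDeriv ℝ m F q‖ ≤ C := by
    intro m
    induction m with
    | zero =>
      intro F hF
      obtain ⟨G, -, hG⟩ := hstep F hF
      refine ⟨contDiff_zero.2 (continuous_iff_continuousAt.2 fun q => (hG q).continuousAt), ?_⟩
      simpa only [norm_iteratedFDeriv_zero] using hdec F hF
    | succ m ih =>
      intro F hF
      obtain ⟨G, hGS, hG⟩ := hstep F hF
      have hc : ∀ μ, ContDiff ℝ m (T μ ∘ G μ) := fun μ =>
        (T μ).contDiff.comp (ih (G μ) (hGS μ)).1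
      have hfd : fderiv ℝ F = fun q => ∑ μ, (T μ ∘ G μ) q := funext fun q => (hG q).fderiv
      refine ⟨contDiff_succ_iff_hasFDerivAt.2 ⟨_, ContDiff.sum fun μ _ => hc μ, hG⟩, fun k => ?_⟩
      choose C hC using fun μ => (ih (G μ) (hGS μ)).2 k
      refine ⟨∑ μ, ‖T μ‖ * C μ, fun q => ?_⟩
      rw [← norm_iteratedFDeriv_fderiv, hfd,
        iteratedFDeriv_fun_sum_apply fun μ _ => (hc μ).contDiffAt]
      calc ‖q‖ ^ k * ‖∑ μ, iteratedFDeriv ℝ m (T μ ∘ G μ) q‖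
          ≤ ‖q‖ ^ k * ∑ μ, ‖T μ‖ * ‖iteratedFDeriv ℝ m (G μ) q‖ := by
            gcongr
            refine (norm_sum_le _ _).trans (Finset.sum_le_sum fun μ _ => ?_)
            exact (T μ).norm_iteratedFDeriv_comp_left (ih (G μ) (hGS μ)).1.contDiffAt le_rfl
        _ = ∑ μ, ‖T μ‖ * (‖q‖ ^ k * ‖iteratedFDeriv ℝ m (G μ) q‖) := by
            rw [Finset.mul_sum]
            exact Finset.sum_congr rfl fun μ _ => by ring
        _ ≤ _ := Finset.sum_le_sum fun μ _ => by gcongr; exact hC μ q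
  exact ⟨⟨F, contDiff_infty.2 fun m => (key m F hF).1, fun k m => (key m F hF).2 k⟩, rfl⟩

/-! ### Averages over dilations -/

/-- Continuous weights which decay faster than every exponential. -/
structure IsFastWeight {n : ℕ} (w : Space n → ℂ) : Prop where
  cont : Continuous w
  integrable : ∀ c : ℝ, Integrable fun p => Real.exp (c * ‖p‖) * ‖w p‖

/-- The weight `w` multiplied by `exp (a_μ p_μ)`. -/
def expWeight {n : ℕ} (a : Fin (n + 1) → ℝ) (μ : Fin (n + 1)) (w : Space n → ℂ) (p : Space n) : ℂ :=
  (Real.exp (a μ * p μ) : ℂ) * w p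

/-- Differentiating an average produces this factor in its weight; the growth at rate `|a μ|` is
absorbed by raising `c`. -/
theorem IsFastWeight.expWeight {n : ℕ} {w : Space n → ℂ} (hw : IsFastWeight w)
    (a : Fin (n + 1) → ℝ) (μ : Fin (n + 1)) : IsFastWeight (expWeight a μ w) := by
  have hc : Continuous (WarpedFRW.expWeight a μ w) := by
    have := hw.cont
    unfold WarpedFRW.expWeight
    fun_prop
  refine ⟨hc, fun c => (hw.integrable (c + |a μ|)).mono' (by fun_prop) (ae_of_all _ fun p => ?_)⟩
  rw [WarpedFRW.expWeight, norm_mul, norm_norm, norm_mul, Complex.norm_real, Real.norm_eq_abs,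
    Real.norm_eq_abs, Real.abs_exp, Real.abs_exp, ← mul_assoc, ← Real.exp_add]
  gcongr
  have h1 := (le_abs_self (a μ * p μ)).trans_eq (abs_mul _ _)
  have h2 := mul_le_mul_of_nonneg_left (PiLp.norm_apply_le p μ) (abs_nonneg (a μ))
  rw [Real.norm_eq_abs] at h2
  linarith

/-- The average `∫ w(p) U(p) f dp`. -/
def smear {n : ℕ} (a : Fin (n + 1) → ℝ) (w : Space n → ℂ) (f : Space n → ℂ) (q : Space n) : ℂ :=
  ∫ p, w p * dilate a p f q

theorem continuous_dilate {n : ℕ} (a : Fin (n + 1) → ℝ) (ψ : 𝓢(Space n, ℂ)) :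
    Continuous fun z : Space n × Space n => dilate a z.1 ψ z.2 := by
  have h : Continuous fun z : Space n × Space n =>
      diagMap (fun μ => Real.exp (a μ * z.1 μ)) z.2 := by
    have : (fun z : Space n × Space n => diagMap (fun μ => Real.exp (a μ * z.1 μ)) z.2) =
        fun z => WithLp.toLp 2 fun μ => Real.exp (a μ * z.1 μ) * z.2 μ := by
      funext z
      ext μ
      rw [diagMap_apply]
    rw [this]
    fun_prop
  have := ψ.continuous
  unfold dilate
  fun_prop

theorem smear_decay {n : ℕ} (a : Fin (n + 1) → ℝ) {w : Space n → ℂ} (hw : IsFastWeight w)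
    (ψ : 𝓢(Space n, ℂ)) (k : ℕ) : ∃ B : Space n → ℝ, Integrable B ∧
      ∀ p q, (1 + ‖q‖) ^ k * ‖w p * dilate a p ψ q‖ ≤ B p := by
  obtain ⟨C, c, hC, hc, h⟩ := dilate_decay a ψ k
  refine ⟨_, (hw.integrable c).const_mul C, fun p q => ?_⟩
  rw [norm_mul]
  calc (1 + ‖q‖) ^ k * (‖w p‖ * ‖dilate a p ψ q‖)
      = ‖w p‖ * ((1 + ‖q‖) ^ k * ‖dilate a p ψ q‖) := by ring
    _ ≤ ‖w p‖ * (C * Real.exp (c * ‖p‖)) :=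
        mul_le_mul_of_nonneg_left (h p q) (norm_nonneg _)
    _ = _ := by ring

theorem integrable_smear_integrand {n : ℕ} (a : Fin (n + 1) → ℝ) {w : Space n → ℂ}
    (hw : IsFastWeight w) (ψ : 𝓢(Space n, ℂ)) (q : Space n) :
    Integrable fun p => w p * dilate a p ψ q := by
  obtain ⟨B, hB, h⟩ := smear_decay a hw ψ 0
  refine hB.mono' ?_ (ae_of_all _ fun p => by simpa using h p q)
  exact (hw.cont.mul ((continuous_dilate a ψ).comp
    (continuous_id.prodMk continuous_const))).aestronglyMeasurable

theorem fderiv_eq_sum_momentum {n : ℕ} (φ : 𝓢(Space n, ℂ)) (x : Space n) :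
    fderiv ℝ φ x = ∑ μ, (Complex.I * momentum μ φ x) • coordFunctional μ := by
  ext v
  have hv : v = ∑ μ, v μ • EuclideanSpace.single μ (1 : ℝ) := by
    ext ν
    simp [Pi.single_apply]
  conv_lhs => rw [hv, map_sum]
  rw [sum_apply]
  refine Finset.sum_congr rfl fun μ _ => ?_
  rw [map_smul, smul_apply, momentum_apply, coordFunctional_apply,
    Complex.real_smul, smul_eq_mul, ← mul_assoc, mul_neg, Complex.I_mul_I, neg_neg, one_mul,
    mul_comm]

theorem hasFDerivAt_dilate {n : ℕ} (a : Fin (n + 1) → ℝ) (p : Space n) (ψ : 𝓢(Space n, ℂ))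
    (q : Space n) : HasFDerivAt (dilate a p ψ) (∑ μ, (Complex.I * ((Real.exp (a μ * p μ) : ℂ) *
      dilate a p (momentum μ ψ) q)) • coordFunctional μ) q := by
  have h := (schwartzDilation a p ψ).hasFDerivAt q
  rw [fderiv_eq_sum_momentum] at h
  simp_rw [momentum_schwartzDilation] at h
  exact h

theorem integrable_sum_smul {α ι V : Type*} [MeasurableSpace α] {m : Measure α} [Fintype ι]
    [NormedAddCommGroup V] [NormedSpace ℂ V] {g : ι → α → ℂ} (hg : ∀ i, Integrable (g i) m)
    (L : ι → V) : Integrable (fun p => ∑ i, g i p • L i) m :=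
  integrable_finsetSum _ fun i _ => (hg i).smul_const (L i)

theorem integral_sum_smul {α ι V : Type*} [MeasurableSpace α] {m : Measure α} [Fintype ι]
    [NormedAddCommGroup V] [NormedSpace ℂ V] [CompleteSpace V] {g : ι → α → ℂ}
    (hg : ∀ i, Integrable (g i) m) (L : ι → V) :
    ∫ p, ∑ i, g i p • L i ∂m = ∑ i, (∫ p, g i p ∂m) • L i := by
  rw [integral_finsetSum _ fun i _ => (hg i).smul_const (L i)]
  exact Finset.sum_congr rfl fun i _ => integral_smul_const _ _

/-- Differentiation under the integral, using `P^μ U(p) = e^{a_μ p_μ} U(p) P^μ`. The result is a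
combination of averages of the same kind. -/
theorem hasFDerivAt_smear {n : ℕ} (a : Fin (n + 1) → ℝ) {w : Space n → ℂ} (hw : IsFastWeight w)
    (ψ : 𝓢(Space n, ℂ)) (q : Space n) : HasFDerivAt (smear a w ψ)
      (∑ μ, (Complex.I * smear a (expWeight a μ w) (momentum μ ψ) q) • coordFunctional μ) q := by
  have hterm : ∀ μ q, Integrable fun p =>
      Complex.I * (expWeight a μ w p * dilate a p (momentum μ ψ) q) := fun μ q =>
    (integrable_smear_integrand a (hw.expWeight a μ) (momentum μ ψ) q).const_mul _
  choose B hB hle using fun μ => smear_decay a (hw.expWeight a μ) (momentum μ ψ) 0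
  have hbound : ∀ p q, ‖∑ μ, (Complex.I * (expWeight a μ w p * dilate a p (momentum μ ψ) q)) •
      (coordFunctional μ : Space n →L[ℝ] ℂ)‖ ≤
      ∑ μ, B μ p * ‖(coordFunctional μ : Space n →L[ℝ] ℂ)‖ := fun p q => by
    refine (norm_sum_le _ _).trans (Finset.sum_le_sum fun μ _ => ?_)
    rw [norm_smul, norm_mul, Complex.norm_I, one_mul]
    refine mul_le_mul_of_nonneg_right ?_ (norm_nonneg _)
    simpa using hle μ p q
  have hdiff : ∀ p q, HasFDerivAt (fun q => w p * dilate a p ψ q)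
      (∑ μ, (Complex.I * (expWeight a μ w p * dilate a p (momentum μ ψ) q)) •
        coordFunctional μ) q := fun p q => by
    refine ((hasFDerivAt_dilate a p ψ q).const_mul (w p)).congr_fderiv ?_
    rw [Finset.smul_sum]
    refine Finset.sum_congr rfl fun μ _ => ?_
    rw [smul_smul, expWeight]
    congr 1
    ring
  have hF'int := integrable_sum_smul (fun μ => hterm μ q)
    (coordFunctional : Fin (n + 1) → Space n →L[ℝ] ℂ)
  have hBint := integrable_finsetSum Finset.univ fun μ _ =>
    (hB μ).mul_const ‖(coordFunctional μ : Space n →L[ℝ] ℂ)‖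
  have hFint := fun q => integrable_smear_integrand a hw ψ q
  have hval : ∫ p, ∑ μ, (Complex.I * (expWeight a μ w p * dilate a p (momentum μ ψ) q)) •
      (coordFunctional μ : Space n →L[ℝ] ℂ) =
      ∑ μ, (Complex.I * smear a (expWeight a μ w) (momentum μ ψ) q) • coordFunctional μ := by
    rw [integral_sum_smul fun μ => hterm μ q]
    refine Finset.sum_congr rfl fun μ _ => ?_
    rw [integral_const_mul]
    rfl
  rw [← hval]
  exact hasFDerivAt_integral_of_dominated_of_fderiv_le (𝕜 := ℝ) (μ := volume)
    (F := fun (q p : Space n) => w p * dilate a p ψ q)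
    (F' := fun (q p : Space n) => ∑ μ, (Complex.I * (expWeight a μ w p *
      dilate a p (momentum μ ψ) q)) • (coordFunctional μ : Space n →L[ℝ] ℂ))
    (bound := fun p => ∑ μ, B μ p * ‖(coordFunctional μ : Space n →L[ℝ] ℂ)‖)
    Filter.univ_mem (Eventually.of_forall fun q => (hFint q).aestronglyMeasurable) (hFint q)
    hF'int.aestronglyMeasurable (ae_of_all _ fun p q _ => hbound p q) hBint
    (ae_of_all _ fun p q _ => hdiff p q)

theorem exists_schwartzMap_smear {n : ℕ} (a : Fin (n + 1) → ℝ) {w : Space n → ℂ}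
    (hw : IsFastWeight w) (ψ : 𝓢(Space n, ℂ)) : ∃ φ : 𝓢(Space n, ℂ), ⇑φ = smear a w ψ := by
  refine exists_schwartzMap_of_stable
    -- The weight and the function must both vary: a derivative multiplies the weight by an
    -- exponential and replaces `ψ` by `i P^μ ψ`.
    (S := {F | ∃ (w : Space n → ℂ) (ψ : 𝓢(Space n, ℂ)), IsFastWeight w ∧ F = smear a w ψ})
    ?_ ?_ ⟨w, ψ, hw, rfl⟩
  · rintro _ ⟨w, ψ, hw, rfl⟩
    refine ⟨fun μ => smear a (expWeight a μ w) (Complex.I • momentum μ ψ : 𝓢(Space n, ℂ)),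
      fun μ => ⟨_, _, hw.expWeight a μ, rfl⟩, fun q => ?_⟩
    refine (hasFDerivAt_smear a hw ψ q).congr_fderiv (Finset.sum_congr rfl fun μ _ => ?_)
    congr 1
    simp only [smear]
    rw [← integral_const_mul]
    refine integral_congr_ae (ae_of_all _ fun p => ?_)
    simp only [dilate, smul_apply, smul_eq_mul]
    ring
  · rintro _ ⟨w, ψ, hw, rfl⟩ k
    obtain ⟨B, hB, h⟩ := smear_decay a hw ψ k
    refine ⟨∫ p, B p, fun q => ?_⟩
    rw [smear, ← abs_of_nonneg (by positivity : 0 ≤ ‖q‖ ^ k), ← Real.norm_eq_abs,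
      ← Complex.norm_real, ← norm_mul, ← integral_const_mul]
    refine norm_integral_le_of_norm_le hB (ae_of_all _ fun p => le_trans ?_ (h p q))
    rw [norm_mul, Complex.norm_real, Real.norm_eq_abs, abs_of_nonneg (by positivity)]
    gcongr
    linarith

/-- The average of a Schwartz function over dilations, as a Schwartz function. -/
def schwartzSmear {n : ℕ} (a : Fin (n + 1) → ℝ) {w : Space n → ℂ} (hw : IsFastWeight w)
    (ψ : 𝓢(Space n, ℂ)) : 𝓢(Space n, ℂ) := (exists_schwartzMap_smear a hw ψ).choose

theorem coe_schwartzSmear {n : ℕ} (a : Fin (n + 1) → ℝ) {w : Space n → ℂ} (hw : IsFastWeight w)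
    (ψ : 𝓢(Space n, ℂ)) : ⇑(schwartzSmear a hw ψ) = smear a w ψ :=
  (exists_schwartzMap_smear a hw ψ).choose_spec

theorem momentum_schwartzSmear {n : ℕ} (a : Fin (n + 1) → ℝ) {w : Space n → ℂ}
    (hw : IsFastWeight w) (ψ : 𝓢(Space n, ℂ)) (μ : Fin (n + 1)) :
    momentum μ (schwartzSmear a hw ψ) = schwartzSmear a (hw.expWeight a μ) (momentum μ ψ) := by
  ext q
  rw [momentum_apply, coe_schwartzSmear, coe_schwartzSmear, (hasFDerivAt_smear a hw ψ q).fderiv,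
    sum_apply, Finset.sum_eq_single μ]
  · rw [smul_apply, coordFunctional_apply]
    simp only [PiLp.single_apply, if_true, Complex.ofReal_one, smul_eq_mul, mul_one]
    rw [← mul_assoc, neg_mul, Complex.I_mul_I, neg_neg, one_mul]
  · intro ν _ hν
    rw [smul_apply, coordFunctional_apply]
    simp [hν]
  · exact fun h => absurd (Finset.mem_univ _) h

/-! ### Averages in the spectral representation -/

theorem exists_mem_funGraph_of_bounded {n : ℕ} (a : Fin (n + 1) → ℝ) {f : Space n → ℂ}
    (hf : Measurable f) {C : ℝ} (hC : ∀ x, ‖f x‖ ≤ C) (η : Hil n) : ∃ ζ, (η, ζ) ∈ funGraph a f := by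
  obtain ⟨E, hE⟩ := exists_boundedMul (e := fun ξ => f (spectralPoint a ξ))
    (hf.comp (continuous_spectralPoint a).measurable).aestronglyMeasurable fun ξ => hC _
  obtain ⟨ζ, hζ⟩ := exists_mellin_eq fun σ => E (mellin σ η)
  exact ⟨ζ, fun σ => by rw [hζ]; exact hE _⟩

/-- The Fourier transform of a weight. -/
def weightTransform {n : ℕ} (w : Space n → ℂ) (x : Space n) : ℂ := ∫ p, w p * character p x

theorem IsFastWeight.integrable_self {n : ℕ} {w : Space n → ℂ} (hw : IsFastWeight w) :
    Integrable w :=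
  (hw.integrable 0).mono' hw.cont.aestronglyMeasurable (ae_of_all _ fun p => by simp)

theorem continuous_weightTransform {n : ℕ} {w : Space n → ℂ} (hw : IsFastWeight w) :
    Continuous (weightTransform w) := by
  have hc := hw.cont
  refine continuous_of_dominated (bound := fun p => ‖w p‖) (fun x => ?_)
    (fun x => ae_of_all _ fun p => by rw [norm_mul, norm_character, mul_one])
    hw.integrable_self.norm (ae_of_all _ fun p => ?_)
  · exact (hc.mul (continuous_character.comp
      (continuous_id.prodMk continuous_const))).aestronglyMeasurable
  · exact continuous_const.mul (continuous_character.comp (continuous_const.prodMk continuous_id))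

theorem norm_weightTransform_le {n : ℕ} (w : Space n → ℂ) (x : Space n) :
    ‖weightTransform w x‖ ≤ ∫ p, ‖w p‖ := by
  refine (norm_integral_le_integral_norm _).trans_eq (integral_congr_ae (ae_of_all _ fun p => ?_))
  simp only [norm_mul, norm_character, mul_one]

/-- The average is a pointwise integral in `q`; Fubini makes it a weak average of the vectors `U(p)
ψ`. The decay `(1 + ‖q‖)^{-(n+2)}` is square integrable, hence integrable against `Ψ`. -/
theorem inner_schwartzSmear {n : ℕ} (a : Fin (n + 1) → ℝ) {w : Space n → ℂ} (hw : IsFastWeight w)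
    (ψ : 𝓢(Space n, ℂ)) (Ψ : Hil n) : ⟪Ψ, (schwartzSmear a hw ψ).toLp 2 volume⟫_ℂ =
      ∫ p, w p * ⟪Ψ, expCoord a p (ψ.toLp 2 volume)⟫_ℂ := by
  obtain ⟨B, hB, hle⟩ := smear_decay a hw ψ (n + 2)
  have hi : Integrable (Function.uncurry fun (q p : Space n) =>
      (w p * dilate a p ψ q) * (starRingEnd ℂ) (Ψ q)) (volume.prod volume) := by
    have h1 : Integrable fun q : Space n => ‖Ψ q‖ * (1 * ((1 + ‖q‖) ^ (n + 2))⁻¹) := by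
      refine (Lp.memLp Ψ).norm.integrable_mul (p := 2) (q := 2) ?_
      exact (memLp_two_iff_integrable_sq (by
        refine Continuous.aestronglyMeasurable (continuous_const.mul (Continuous.inv₀ ?_ ?_))
        · fun_prop
        · intro q
          positivity)).2 (integrable_sq_inv_one_add_norm_pow 1)
    refine (h1.mul_prod hB).mono' ?_ (ae_of_all _ fun z => ?_)
    · refine (Continuous.aestronglyMeasurable ?_).mul ?_
      · exact (hw.cont.comp continuous_snd).mul
          ((continuous_dilate a ψ).comp (continuous_snd.prodMk continuous_fst))
      · exact Complex.continuous_conj.comp_aestronglyMeasurable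
          (Lp.aestronglyMeasurable Ψ).comp_fst
    · have h2 := hle z.2 z.1
      have h3 : ‖w z.2 * dilate a z.2 ψ z.1‖ ≤ ((1 + ‖z.1‖) ^ (n + 2))⁻¹ * B z.2 := by
        rwa [← div_eq_inv_mul, le_div_iff₀ (by positivity), mul_comm]
      simp only [Function.uncurry]
      rw [norm_mul, RCLike.norm_conj]
      calc _ ≤ (((1 + ‖z.1‖) ^ (n + 2))⁻¹ * B z.2) * ‖Ψ z.1‖ := by gcongr
        _ = _ := by ring
  calc _ = ∫ q, ∫ p, (w p * dilate a p ψ q) * (starRingEnd ℂ) (Ψ q) := by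
        rw [L2.inner_def]
        refine integral_congr_ae ?_
        filter_upwards [(schwartzSmear a hw ψ).coeFn_toLp 2 volume] with q hq
        rw [hq, coe_schwartzSmear, RCLike.inner_apply, smear, ← integral_mul_const]
    _ = _ := by
        rw [integral_integral_swap hi]
        refine integral_congr_ae (ae_of_all _ fun p => ?_)
        simp only
        rw [L2.inner_def, ← integral_const_mul]
        refine integral_congr_ae ?_
        filter_upwards [expCoord_toLp_coe a p ψ] with q hq
        rw [hq, RCLike.inner_apply, mul_assoc]

/-- Averaging the characters of `U(p)` over `p` gives the Fourier transform of the weight. The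
transform is bounded, so `weightTransform w` applied to `X` is defined on `ψ`, and the two vectors
are compared by pairing with every `Ψ`. -/
theorem schwartzSmear_mem_funGraph {n : ℕ} (a : Fin (n + 1) → ℝ) {w : Space n → ℂ}
    (hw : IsFastWeight w) (ψ : 𝓢(Space n, ℂ)) :
    (ψ.toLp 2 volume, (schwartzSmear a hw ψ).toLp 2 volume) ∈ funGraph a (weightTransform w) := by
  obtain ⟨ζ, hζ⟩ := exists_mem_funGraph_of_bounded a (continuous_weightTransform hw).measurable
    (norm_weightTransform_le w) (ψ.toLp 2 volume)
  suffices h : (schwartzSmear a hw ψ).toLp 2 volume = ζ by rwa [h]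
  refine ext_inner_left ℂ fun Ψ => ?_
  have hi : Integrable (Function.uncurry fun (p ξ : Space n) =>
      (w p * spectralDensity Ψ (ψ.toLp 2 volume) ξ) * character p (spectralPoint a ξ))
      (volume.prod volume) := by
    refine (hw.integrable_self.mul_prod (integrable_spectralDensity Ψ _)).mul_bdd
      (c := 1) ?_ (ae_of_all _ fun z => ?_)
    · exact (continuous_character.comp (continuous_fst.prodMk
        ((continuous_spectralPoint a).comp continuous_snd))).aestronglyMeasurable
    · rw [norm_character]
  rw [inner_schwartzSmear, inner_eq_integral_spectralDensity hζ]
  calc _ = ∫ p, ∫ ξ, (w p * spectralDensity Ψ (ψ.toLp 2 volume) ξ) *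
        character p (spectralPoint a ξ) := by
        refine integral_congr_ae (ae_of_all _ fun p => ?_)
        simp only
        rw [inner_eq_integral_spectralDensity (expCoord_mem_funGraph a p _) Ψ,
          ← integral_const_mul]
        simp_rw [mul_assoc]
    _ = _ := by
        rw [integral_integral_swap hi]
        refine integral_congr_ae (ae_of_all _ fun ξ => ?_)
        simp only
        rw [weightTransform, ← integral_const_mul]
        refine integral_congr_ae (ae_of_all _ fun p => ?_)
        simp only
        ring

/-! ### Gaussian weights -/

/-- The Gaussian `exp (-δ ‖p‖² + r · p)`, divided by the integral of `exp (-δ ‖p‖²)`. -/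
def gaussianWeight {n : ℕ} (δ : ℝ) (r p : Space n) : ℂ :=
  ((Real.pi / δ : ℂ) ^ (Fintype.card (Fin (n + 1)) / 2 : ℂ))⁻¹ *
    Complex.exp ((-δ * ‖p‖ ^ 2 + dot r p : ℝ) : ℂ)

theorem mul_sub_mul_sq_le {δ : ℝ} (hδ : 0 < δ) (c t : ℝ) : c * t - δ * t ^ 2 ≤ c ^ 2 / (4 * δ) := by
  rw [le_div_iff₀ (by positivity)]
  linarith [sq_nonneg (c - 2 * δ * t)]

theorem isFastWeight_gaussianWeight {n : ℕ} {δ : ℝ} (hδ : 0 < δ) (r : Space n) :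
    IsFastWeight (gaussianWeight δ r) := by
  have hc : Continuous (gaussianWeight δ r) := by
    unfold gaussianWeight dot
    fun_prop
  set K := ‖((Real.pi / δ : ℂ) ^ (Fintype.card (Fin (n + 1)) / 2 : ℂ))⁻¹‖ with hK
  refine ⟨hc, fun c => (integrable_exp_neg_norm.const_mul
    (K * Real.exp ((c + ‖r‖ + 1) ^ 2 / (4 * δ)))).mono' (by fun_prop) (ae_of_all _ fun p => ?_)⟩
  rw [gaussianWeight, norm_mul, norm_norm, norm_mul, ← hK, ← Complex.ofReal_exp,
    Complex.norm_real, Real.norm_eq_abs, Real.norm_eq_abs, Real.abs_exp, Real.abs_exp,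
    mul_left_comm, mul_assoc, ← Real.exp_add, ← Real.exp_add]
  refine mul_le_mul_of_nonneg_left (Real.exp_le_exp.2 ?_) (norm_nonneg _)
  have h1 := (le_abs_self _).trans (abs_dot_le r p)
  have h2 := mul_sub_mul_sq_le hδ (c + ‖r‖ + 1) ‖p‖
  linarith

theorem expWeight_gaussianWeight {n : ℕ} (a : Fin (n + 1) → ℝ) (μ : Fin (n + 1)) (δ : ℝ)
    (r : Space n) : expWeight a μ (gaussianWeight δ r) =
      gaussianWeight δ (r + EuclideanSpace.single μ (a μ)) := by
  funext p
  have h : dot (r + EuclideanSpace.single μ (a μ)) p = dot r p + a μ * p μ := by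
    simp [dot, add_mul, Finset.sum_add_distrib]
  rw [expWeight, gaussianWeight, gaussianWeight, h, ← add_assoc, mul_left_comm,
    Complex.ofReal_exp, ← Complex.exp_add, ← Complex.ofReal_add, add_comm (a μ * p μ)]

theorem weightTransform_gaussianWeight {n : ℕ} {δ : ℝ} (hδ : 0 < δ) (r x : Space n) :
    weightTransform (gaussianWeight δ r) x =
      Complex.exp ((∑ μ, ((r μ : ℂ) + Complex.I * x μ) ^ 2) / (4 * δ)) := by
  have h := GaussianFourier.integral_cexp_neg_mul_sum_add (b := (δ : ℂ)) (by simpa using hδ)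
    fun μ => (r μ : ℂ) + Complex.I * x μ
  have hne : (Real.pi / δ : ℂ) ≠ 0 := by
    have := Real.pi_ne_zero
    have := hδ.ne'
    simp_all
  rw [weightTransform, ← (PiLp.volume_preserving_toLp (Fin (n + 1))).integral_comp
    (MeasurableEquiv.toLp 2 _).measurableEmbedding]
  simp_rw [gaussianWeight, mul_assoc]
  rw [integral_const_mul, inv_mul_eq_iff_eq_mul₀
    (by rw [Ne, Complex.cpow_eq_zero_iff]; exact fun h => hne h.1), ← h]
  refine integral_congr_ae (ae_of_all _ fun p => ?_)
  simp only [character]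
  rw [← Complex.exp_add, EuclideanSpace.real_norm_sq_eq]
  congr 1
  push_cast
  simp_rw [Finset.mul_sum, ← Finset.sum_add_distrib]
  refine Finset.sum_congr rfl fun μ _ => ?_
  ring

/-- The shift `r` costs a constant factor and a phase; the Gaussian decay in `x` stays. -/
theorem norm_weightTransform_gaussianWeight {n : ℕ} {δ : ℝ} (hδ : 0 < δ) (r x : Space n) :
    ‖weightTransform (gaussianWeight δ r) x‖ =
      Real.exp ((‖r‖ ^ 2 - ‖x‖ ^ 2) / (4 * δ)) := by
  have h : (∑ μ, ((r μ : ℂ) + Complex.I * x μ) ^ 2) / (4 * δ) =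
      (((‖r‖ ^ 2 - ‖x‖ ^ 2) / (4 * δ) : ℝ) : ℂ) +
        ((2 * dot r x / (4 * δ) : ℝ) : ℂ) * Complex.I := by
    rw [EuclideanSpace.real_norm_sq_eq, EuclideanSpace.real_norm_sq_eq, ← Finset.sum_sub_distrib]
    push_cast
    rw [div_mul_eq_mul_div, ← add_div, Finset.mul_sum, Finset.sum_mul, ← Finset.sum_add_distrib]
    congr 1
    refine Finset.sum_congr rfl fun μ _ => ?_
    linear_combination (x μ : ℂ) ^ 2 * Complex.I_sq
  rw [weightTransform_gaussianWeight hδ, h, Complex.exp_add, norm_mul,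
    Complex.norm_exp_ofReal_mul_I, mul_one, ← Complex.ofReal_exp, Complex.norm_real,
    Real.norm_eq_abs, Real.abs_exp]

/-! ### Density of the domains -/

/-- `f(X)` is defined on Gaussian averages over dilations if `f` grows at most exponentially. -/
theorem exists_mem_funGraph_schwartzSmear {n : ℕ} (a : Fin (n + 1) → ℝ) {f : Space n → ℂ}
    (hf : Measurable f) {C κ : ℝ} (hC : ∀ x, ‖f x‖ ≤ C * Real.exp (κ * ‖x‖)) {w : Space n → ℂ}
    (hw : IsFastWeight w) {δ : ℝ} (hδ : 0 < δ) {r : Space n} (hr : w = gaussianWeight δ r)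
    (ψ : 𝓢(Space n, ℂ)) : ∃ ζ, ((schwartzSmear a hw ψ).toLp 2 volume, ζ) ∈ funGraph a f := by
  have hC0 : 0 ≤ C := nonneg_of_mul_nonneg_left ((norm_nonneg _).trans (hC 0)) (Real.exp_pos _)
  have hb : ∀ x, ‖f x * weightTransform w x‖ ≤
      C * Real.exp (κ ^ 2 * δ + ‖r‖ ^ 2 / (4 * δ)) := fun x => by
    rw [norm_mul]
    refine (mul_le_mul_of_nonneg_right (hC x) (norm_nonneg _)).trans ?_
    rw [hr, norm_weightTransform_gaussianWeight hδ, mul_assoc, ← Real.exp_add]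
    refine mul_le_mul_of_nonneg_left (Real.exp_le_exp.2 ?_) hC0
    -- Completing the square with `1 / (4δ)`, the rate of the transformed Gaussian, in place of `δ`;
    -- the maximum is `κ² δ`.
    have h := mul_sub_mul_sq_le (δ := 1 / (4 * δ)) (by positivity) κ ‖x‖
    have h2 : κ ^ 2 / (4 * (1 / (4 * δ))) = κ ^ 2 * δ := by field_simp
    rw [h2] at h
    have h3 : (‖r‖ ^ 2 - ‖x‖ ^ 2) / (4 * δ) = ‖r‖ ^ 2 / (4 * δ) - 1 / (4 * δ) * ‖x‖ ^ 2 := by ring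
    linarith
  obtain ⟨ζ, hζ⟩ := exists_mem_funGraph_of_bounded a
    (hf.mul (continuous_weightTransform hw).measurable) hb (ψ.toLp 2 volume)
  -- The average is `weightTransform w` of `X` applied to `ψ`, and the product of `f` with this
  -- transform is bounded, hence defined at `ψ`.
  exact ⟨ζ, funGraph_of_mul (schwartzSmear_mem_funGraph a hw ψ) hζ fun x => rfl⟩

/-- Two momenta multiply the weight by `e^{2 a_μ p_μ}`, which only shifts the linear term of the
Gaussian, so the criterion for functions of exponential growth still applies. -/
theorem schwartzSmear_mem_domain {n : ℕ} {a q : Fin (n + 1) → ℝ} {N : Space n → ℝ}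
    {s : Fin n → ℝ → ℝ} (hm : ∀ μ, Measurable (metricDiag N s μ))
    (hC : ∀ μ, ∃ C κ : ℝ, ∀ x, |metricDiag N s μ x| ≤ C * Real.exp (κ * ‖x‖)) {δ : ℝ}
    (hδ : 0 < δ) (ψ : 𝓢(Space n, ℂ)) :
    (schwartzSmear a (isFastWeight_gaussianWeight hδ 0) ψ).toLp 2 volume ∈
      (lineElement a q (metric N s)).domain := by
  have h : ∀ μ, ∃ y, ((diffSq a q μ (schwartzSmear a (isFastWeight_gaussianWeight hδ 0) ψ)).toLp 2
      volume, y) ∈ funGraph a fun x => ((metricDiag N s μ x : ℝ) : ℂ) := fun μ => by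
    obtain ⟨C, κ, hC⟩ := hC μ
    obtain ⟨ζ, hζ⟩ := exists_mem_funGraph_schwartzSmear a
      (Complex.measurable_ofReal.comp (hm μ)) (C := C) (κ := κ)
      (fun x => by simpa using hC x)
      (((isFastWeight_gaussianWeight hδ 0).expWeight a μ).expWeight a μ) hδ
      (by rw [expWeight_gaussianWeight, expWeight_gaussianWeight]) (momentum μ (momentum μ ψ))
    refine ⟨(((q μ * a μ) ^ 2 : ℝ) : ℂ) • ζ, ?_⟩
    rw [diffSq_apply, momentum_schwartzSmear, momentum_schwartzSmear]
    exact Submodule.smul_mem _ (((q μ * a μ) ^ 2 : ℝ) : ℂ) hζ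
  choose y hy using h
  exact LinearPMap.mem_domain_of_mem_graph (mem_graph_lineElement.2 ⟨_, rfl, y, hy, rfl⟩)

/-- With `δ = m + 1` the normalised weights concentrate at `p = 0`; their transforms are bounded by
1 and tend to 1 pointwise. -/
theorem tendsto_schwartzSmear {n : ℕ} (a : Fin (n + 1) → ℝ) (ψ : 𝓢(Space n, ℂ)) :
    Tendsto (fun m : ℕ => (schwartzSmear a (isFastWeight_gaussianWeight (n := n)
      (Nat.cast_add_one_pos (α := ℝ) m) 0) ψ).toLp 2 volume) atTop (𝓝 (ψ.toLp 2 volume)) := by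
  refine tendsto_of_bounded_functions (h₀ := fun _ => 1) (C := 2)
    (fun m => schwartzSmear_mem_funGraph a _ ψ) (fun σ => ae_of_all _ fun ξ => (one_mul _).symm)
    (fun m x => ?_) fun x => ?_
  · refine (norm_sub_le _ _).trans ?_
    rw [norm_weightTransform_gaussianWeight (Nat.cast_add_one_pos m), norm_one]
    have : Real.exp ((‖(0 : Space n)‖ ^ 2 - ‖x‖ ^ 2) / (4 * ((m : ℝ) + 1))) ≤ 1 := by
      rw [Real.exp_le_one_iff]
      refine div_nonpos_of_nonpos_of_nonneg ?_ (by positivity)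
      simp
    linarith
  · simp_rw [fun m : ℕ => weightTransform_gaussianWeight (Nat.cast_add_one_pos (α := ℝ) m) 0 x]
    rw [← Complex.exp_zero]
    refine (Complex.continuous_exp.tendsto 0).comp ?_
    have h : Tendsto (fun m : ℕ => (((1 / ((m : ℝ) + 1) : ℝ)) : ℂ)) atTop (𝓝 ((0 : ℝ) : ℂ)) :=
      (Complex.continuous_ofReal.tendsto 0).comp tendsto_one_div_add_atTop_nhds_zero_nat
    have h2 := h.const_mul ((∑ μ, (((0 : Space n) μ : ℂ) + Complex.I * x μ) ^ 2) / 4)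
    rw [Complex.ofReal_zero, mul_zero] at h2
    refine h2.congr fun m => ?_
    push_cast
    rw [div_mul_div_comm, mul_one]

/-- The factor `exp (v_μ · x)` preserves measurability and exponential growth, so the same Gaussian
averages lie in both domains. -/
theorem dense_domain_inf_domain {n : ℕ} {a q : Fin (n + 1) → ℝ} {N N' : Space n → ℝ}
    {s s' : Fin n → ℝ → ℝ} {v : Fin (n + 1) → Space n}
    (hv : ∀ μ x, metricDiag N' s' μ x = Real.exp (dot (v μ) x) * metricDiag N s μ x)
    (hm : ∀ μ, Measurable (metricDiag N s μ))
    (hC : ∀ μ, ∃ C κ : ℝ, ∀ x, |metricDiag N s μ x| ≤ C * Real.exp (κ * ‖x‖)) :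
    Dense (((lineElement a q (metric N s)).domain ⊓
      (lineElement a q (metric N' s')).domain : Submodule ℂ (Hil n)) : Set (Hil n)) := by
  have hm' : ∀ μ, Measurable (metricDiag N' s' μ) := fun μ => by
    rw [show metricDiag N' s' μ = fun x => Real.exp (dot (v μ) x) * metricDiag N s μ x from
      funext (hv μ)]
    exact (by unfold dot; fun_prop : Continuous fun x => Real.exp (dot (v μ) x)).measurable.mul
      (hm μ)
  have hC' : ∀ μ, ∃ C κ : ℝ, ∀ x, |metricDiag N' s' μ x| ≤ C * Real.exp (κ * ‖x‖) := fun μ => by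
    obtain ⟨C, κ, h⟩ := hC μ
    refine ⟨C, ‖v μ‖ + κ, fun x => ?_⟩
    rw [hv, abs_mul, Real.abs_exp, add_mul, Real.exp_add, mul_left_comm]
    exact mul_le_mul (Real.exp_le_exp.2 ((le_abs_self _).trans (abs_dot_le _ _))) (h x)
      (abs_nonneg _) (Real.exp_pos _).le
  have hdense : DenseRange fun ψ : 𝓢(Space n, ℂ) => ψ.toLp 2 (volume : Measure (Space n)) :=
    SchwartzMap.denseRange_toLpCLM (F := ℂ) (E := Space n) (p := 2) (μ := volume) (by norm_num)
  rw [dense_iff_closure_eq, ← Set.univ_subset_iff, ← hdense.closure_range]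
  refine closure_minimal ?_ isClosed_closure
  rintro _ ⟨ψ, rfl⟩
  exact mem_closure_of_tendsto (tendsto_schwartzSmear a ψ) (Eventually.of_forall fun m =>
    ⟨schwartzSmear_mem_domain hm hC (Nat.cast_add_one_pos m) ψ,
      schwartzSmear_mem_domain hm' hC' (Nat.cast_add_one_pos m) ψ⟩)

/-! ### The metrics -/

theorem measurable_metricDiag_one {n : ℕ} {scale : ℝ → ℝ} (hscale : Measurable scale)
    (μ : Fin (n + 1)) :
    Measurable (metricDiag (n := n) (fun _ => 1) (fun _ => scale) μ) := by
  refine Fin.cases ?_ (fun i => ?_) μ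
  · exact measurable_const
  · exact ((hscale.comp (EuclideanSpace.proj (𝕜 := ℝ) (0 : Fin (n + 1))).continuous.measurable).pow_const
      2).neg

theorem exists_abs_metricDiag_one_le {n : ℕ} {scale : ℝ → ℝ} {C κ : ℝ}
    (h : ∀ t, |scale t| ≤ C * Real.exp (κ * |t|)) (μ : Fin (n + 1)) :
    ∃ C κ : ℝ, ∀ x, |metricDiag (n := n) (fun _ => 1) (fun _ => scale) μ x| ≤
      C * Real.exp (κ * ‖x‖) := by
  -- The spatial component is minus a square, which squares `C` and doubles the rate; the absolute
  -- value of `κ` is needed to pass from `|x 0|` to `‖x‖`.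
  refine Fin.cases ⟨1, 0, fun x => ?_⟩ (fun i => ⟨C ^ 2, 2 * |κ|, fun x => ?_⟩) μ
  · simp [metricDiag]
  · simp only [metricDiag, Fin.cons_succ, abs_neg, abs_pow]
    calc |scale (x 0)| ^ 2 ≤ (C * Real.exp (κ * |x 0|)) ^ 2 := by
          gcongr
          exact h _
      _ = C ^ 2 * Real.exp (2 * (κ * |x 0|)) := by
          rw [mul_pow, ← Real.exp_nat_mul, Nat.cast_ofNat]
      _ ≤ _ := by
          rw [mul_assoc]
          have h1 := PiLp.norm_apply_le x 0
          rw [Real.norm_eq_abs] at h1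
          gcongr
          exact le_abs_self κ

/-- The components of the deformed metric are exponentials times those of the original one. -/
theorem metricDiag_deformed {n : ℕ} {a : Fin (n + 1) → ℝ}
    {Θ : Matrix (Fin (n + 1)) (Fin (n + 1)) ℝ} (hskew : Θᵀ = -Θ)
    (hΘ : ∀ i j : Fin n, Θ i.succ j.succ = 0) {scale : ℝ → ℝ} {b : Fin n → ℝ}
    (hb : ∀ i, b i = a 0 * Θ 0 i.succ) {newScale : Fin n → ℝ → ℝ}
    (hnew : ∀ i t, newScale i t ^ 2 =
      Real.exp (-2 * (a i.succ * Θ i.succ 0) * t) * scale t ^ 2) (μ : Fin (n + 1)) (x : Space n) :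
    metricDiag (fun x => Real.exp (-2 * ∑ i, b i * x i.succ)) newScale μ x =
      Real.exp (dot (WithLp.toLp 2 fun ν => -2 * a μ * Θ μ ν) x) *
        metricDiag (fun _ => 1) (fun _ => scale) μ x := by
  -- Without this the factor in front of `dt²` would depend on time. In the spatial components it is
  -- the vanishing of `Θ i.succ j.succ` that leaves dependence on time alone.
  have h00 : Θ 0 0 = 0 := by
    have h := congrFun (congrFun hskew 0) 0
    rw [Matrix.transpose_apply, Matrix.neg_apply] at h
    linarith
  refine Fin.cases ?_ (fun i => ?_) μ
  · simp only [metricDiag, Fin.cons_zero, mul_one, dot, Fin.sum_univ_succ, h00, hb, mul_zero,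
      zero_mul, zero_add, Finset.mul_sum]
    congr 1
    exact Finset.sum_congr rfl fun i _ => by ring
  · simp only [metricDiag, Fin.cons_succ, hnew, dot, Fin.sum_univ_succ, hΘ, mul_zero, zero_mul,
      Finset.sum_const_zero, add_zero, mul_neg]
    congr 3
    ring

end WarpedFRW

end

theorem mainTheorem8 (n : ℕ) (a q : Fin (n + 1) → ℝ)
    (Θ : Matrix (Fin (n + 1)) (Fin (n + 1)) ℝ) (hskew : Θᵀ = -Θ)
    (hΘ : ∀ i j : Fin n, Θ i.succ j.succ = 0)
    (scale : ℝ → ℝ) (hscale : Measurable scale)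
    (b : Fin n → ℝ) (hb : ∀ i, b i = a 0 * Θ 0 i.succ)
    (newScale : Fin n → ℝ → ℝ)
    (hnew : ∀ i t, newScale i t ^ 2 =
      Real.exp (-2 * (a i.succ * Θ i.succ 0) * t) * scale t ^ 2) :
    -- the operators used are the exponentials and functions of the coordinates
    WarpedFRW.IsExponentialOf (WarpedFRW.expCoord a) (WarpedFRW.coordOp a) ∧
    (∀ p, WarpedFRW.funOp a (fun x => Complex.exp (Complex.I * ((∑ μ, p μ * x μ : ℝ) : ℂ))) =
      WarpedFRW.everywhere (WarpedFRW.expCoord a p)) ∧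
    -- the deformed line-element
    (∀ (Φ : WarpedFRW.Hil n)
      (_ : Φ ∈ (WarpedFRW.lineElement a q
        (WarpedFRW.metric (fun _ => 1) (fun _ => scale))).domain)
      (h : Φ ∈ (WarpedFRW.lineElement a q
        (WarpedFRW.metric (fun x => Real.exp (-2 * ∑ i, b i * x i.succ)) newScale)).domain),
      WarpedFRW.HasWarpedConvolution a Θ
        (WarpedFRW.lineElement a q (WarpedFRW.metric (fun _ => 1) (fun _ => scale))) Φ
        (WarpedFRW.lineElement a q
          (WarpedFRW.metric (fun x => Real.exp (-2 * ∑ i, b i * x i.succ)) newScale) ⟨Φ, h⟩)) ∧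
    -- the vectors concerned are dense
    ((∃ C κ : ℝ, ∀ t, |scale t| ≤ C * Real.exp (κ * |t|)) →
      Dense (((WarpedFRW.lineElement a q
          (WarpedFRW.metric (fun _ => 1) (fun _ => scale))).domain ⊓
        (WarpedFRW.lineElement a q
          (WarpedFRW.metric (fun x => Real.exp (-2 * ∑ i, b i * x i.succ)) newScale)).domain :
          Submodule ℂ (WarpedFRW.Hil n)) : Set (WarpedFRW.Hil n))) := by
  have hv := WarpedFRW.metricDiag_deformed hskew hΘ hb hnew
  refine ⟨WarpedFRW.isExponentialOf_expCoord a, WarpedFRW.funOp_character a, fun Φ h₀ h => ?_, ?_⟩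
  · refine WarpedFRW.hasWarpedConvolution_lineElement hv (fun μ x => ?_)
      (LinearPMap.mem_graph _ ⟨Φ, h₀⟩) (LinearPMap.mem_graph _ ⟨Φ, h⟩)
    simp only [WarpedFRW.thetaVec, WarpedFRW.dot, Finset.mul_sum]
    exact Finset.sum_congr rfl fun ν _ => by ring
  · rintro ⟨C, κ, h⟩
    exact WarpedFRW.dense_domain_inf_domain hv (WarpedFRW.measurable_metricDiag_one hscale)
      (WarpedFRW.exists_abs_metricDiag_one_le h)
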